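/- Let $n\ge 3$ be an integer and let $\Omega\subset\mathbb R^n$ be a nonempty open set. A map $f\in W^{1,1}_{\mathrm{loc}}(\Omega;\mathbb R^n)$ with weak derivative $Df$ is called weakly $K$-quasiregular if either $\det Df\ge 0$ a.e. in $\Omega$ or $\det Df\le 0$ a.e. in $\Omega$, and $$\max_{|\xi|=1}|Df(x)\xi|\le K\min_{|\xi|=1}|Df(x)\xi|\quad\text{for a.e. }x\in\Omega .$$ Its singular set is $$S_f=\Big\{x\in\Omega:\ \limsup_{r\to0^+}\frac1{|B(x,r)|}\int_{B(x,r)}|f(y)|\,dy=\infty\Big\}.$$ **Theorem 1.2.** (i) For all real $K\ge1$ and $\varepsilon>0$ there is a weakly $K$-quasiregular map $f\in W^{1,1}_{\mathrm{loc}}(\Omega;\mathbb R^n)$ whose singular set $S_f$ has Hausdorff dimension at least $$\min\Big\{\frac{nK}{K+1},\,n-1\Big\}-\varepsilon .$$ (ii) For every real $p\in(1,n)$ there is a constant $K_p\ge1$, depending only on $n$ and $p$, such that for every $\varepsilon>0$ there is a weakly $K_p$-quasiregular map $f\in W^{1,p}_{\mathrm{loc}}(\Omega;\mathbb R^n)$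 whose singular set $S_f$ has Hausdorff dimension at least $n-p-\varepsilon$. -/

import Mathlib

open MeasureTheory Set Filter Topology Metric
open scoped ENNReal ContDiff

/-- `g` is a weak (distributional) derivative of `f : Ω → E` on the open set `Ω`: both are locally
integrable on `Ω`, and `∫_Ω (∂_v φ) f = - ∫_Ω φ (g v)` for every direction `v` and every
`φ ∈ C_c^∞(Ω)`. A map on `Ω` is represented by a map on `E`; its values off `Ω` are irrelevant. -/
def IsWeakDerivOn {n : ℕ} (Ω : Set (EuclideanSpace ℝ (Fin n)))
    (f : EuclideanSpace ℝ (Fin n) → EuclideanSpace ℝ (Fin n))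
    (g : EuclideanSpace ℝ (Fin n) →
      (EuclideanSpace ℝ (Fin n) →L[ℝ] EuclideanSpace ℝ (Fin n))) : Prop :=
  LocallyIntegrableOn f Ω volume ∧ LocallyIntegrableOn g Ω volume ∧
    ∀ φ : EuclideanSpace ℝ (Fin n) → ℝ,
      ContDiff ℝ ∞ φ → HasCompactSupport φ → tsupport φ ⊆ Ω →
        ∀ v : EuclideanSpace ℝ (Fin n),
          ∫ x in Ω, (fderiv ℝ φ x v) • f x = - ∫ x in Ω, φ x • g x v

/-- The local Sobolev space `W^{1,p}_loc(Ω; ℝⁿ)`: `f` has a weak derivative on `Ω`, and `f` and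
this derivative are in `L^p(C)` for every compact `C ⊆ Ω`. -/
def MemSobolevLoc {n : ℕ} (Ω : Set (EuclideanSpace ℝ (Fin n))) (p : ℝ≥0∞)
    (f : EuclideanSpace ℝ (Fin n) → EuclideanSpace ℝ (Fin n)) : Prop :=
  ∃ g : EuclideanSpace ℝ (Fin n) →
      (EuclideanSpace ℝ (Fin n) →L[ℝ] EuclideanSpace ℝ (Fin n)),
    IsWeakDerivOn Ω f g ∧
      ∀ C : Set (EuclideanSpace ℝ (Fin n)), C ⊆ Ω → IsCompact C →
        MemLp f p (volume.restrict C) ∧ MemLp g p (volume.restrict C)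

/-- Weakly `K`-quasiregular maps on `Ω`: `f` has a locally integrable weak derivative `Df`
(that is, `f ∈ W^{1,1}_loc`), the Jacobian `det Df` does not change sign (`≥ 0` a.e. on `Ω`, or
`≤ 0` a.e. on `Ω`), and `max_{|ξ| = 1} |Df(x) ξ| ≤ K min_{|η| = 1} |Df(x) η|` for a.e. `x ∈ Ω`. -/
def IsWeaklyQuasiregular {n : ℕ} (Ω : Set (EuclideanSpace ℝ (Fin n))) (K : ℝ)
    (f : EuclideanSpace ℝ (Fin n) → EuclideanSpace ℝ (Fin n)) : Prop :=
  ∃ Df : EuclideanSpace ℝ (Fin n) →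
      (EuclideanSpace ℝ (Fin n) →L[ℝ] EuclideanSpace ℝ (Fin n)),
    IsWeakDerivOn Ω f Df ∧
      ((∀ᵐ x ∂(volume.restrict Ω), 0 ≤ (Df x).det) ∨
        (∀ᵐ x ∂(volume.restrict Ω), (Df x).det ≤ 0)) ∧
      ∀ᵐ x ∂(volume.restrict Ω), ∀ ξ η : EuclideanSpace ℝ (Fin n),
        ‖ξ‖ = 1 → ‖η‖ = 1 → ‖Df x ξ‖ ≤ K * ‖Df x η‖

/-- The singular set of `f` in `Ω`: the points `x ∈ Ω` at which the upper limit, as `r → 0⁺`, of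
the averages of `|f|` over the balls `B(x,r)` is infinite. -/
noncomputable def singularSet {n : ℕ} (Ω : Set (EuclideanSpace ℝ (Fin n)))
    (f : EuclideanSpace ℝ (Fin n) → EuclideanSpace ℝ (Fin n)) :
    Set (EuclideanSpace ℝ (Fin n)) :=
  {x | x ∈ Ω ∧ limsup (fun r : ℝ => ⨍⁻ y in ball x r, ‖f y‖ₑ ∂volume) (𝓝[>] (0 : ℝ)) = ⊤}

/-! The building block is the radial stretching `S(x) = |x|^(-b) x` with `1 < b < n`. At `x` its
derivative is `|x|^(-b)` times a symmetric map with eigenvalue `1` on the hyperplane orthogonal to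
`x` and `1 - b` along `x`. So it reverses orientation and has distortion `max (b - 1) (1 / (b - 1))`
(`isReversingQuasiconformal_radialStretchDeriv`).

Keep `S` on `t ≤ |x|` and replace it by the dilation `t^(-b) x` on the core `|x| < t`. The result is
Lipschitz, but the core has the wrong orientation. Fill almost all of the core with disjoint balls
`B(c, r)`. Since `S` is the identity on the unit sphere, the dilation can be replaced in each ball
by `t^(-b) c + t^(-b) r f((x - c) / r)`, with `f` the map under construction. Solving this
self-similar equation amounts to summing the iterates of a transfer operator. On `L^p` it has norm
at most `t^(-b) t^(n/p)`, both for the map and for its derivative, so the series converges in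
`W^{1,p}` as soon as `b p < n`. The set where the distortion condition fails lies, up to a null set,
in the union of its own rescaled copies in the balls. Hence its measure is at most `t^n` times
itself, that is, zero (`ae_isReversingQuasiconformal`).

For the singular set, let the packing contain a grid of `M^n` balls of radius `β = t / (4nM)`. In a
nested grid cell of radius `β^k` the map is a constant plus `(t^(-b) β)^k` times a copy of `f`.
Since `f` is odd on the outer annulus, no constant can cancel it, and the averages blow up when
`t^(-b) β > 1` (`le_laverage`, `mem_singularSet`). The singular points so obtained form a Cantor set
of `M^n` pieces with ratio `β`; comparing it with base-`M` expansions in the cube gives dimension at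
least `n s` whenever `1/M ≤ β^s` (`le_dimH_range_limitPoint`). As `M → ∞` with `t^(-b) β = 2`, every
`s < (b - 1) / b` is allowed, so every dimension below `n - n/b` is reached. Part (i) takes `b = K +
1`, or `b` close to `n` when `K ≥ n - 1`; part (ii) takes `b` close to `n/p`. -/

/-- The Euclidean space `ℝⁿ`. -/
abbrev Euc (n : ℕ) := EuclideanSpace ℝ (Fin n)

/-! ### Change of variables under `x ↦ r⁻¹ • (x - c)` -/

section Rescale

variable {n : ℕ}

/-- The homeomorphism `x ↦ r⁻¹ • (x - c)`. -/
noncomputable def rescaleHomeo (c : Euc n) {r : ℝ} (hr : r ≠ 0) : Euc n ≃ₜ Euc n :=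
  (Homeomorph.subRight c).trans (Homeomorph.smulOfNeZero r⁻¹ (inv_ne_zero hr))

theorem rescaleHomeo_apply (c : Euc n) {r : ℝ} (hr : r ≠ 0) (x : Euc n) :
    rescaleHomeo c hr x = r⁻¹ • (x - c) := rfl

theorem map_rescaleHomeo (c : Euc n) {r : ℝ} (hr : 0 < r) :
    Measure.map (rescaleHomeo c hr.ne') volume =
      ENNReal.ofReal (r ^ n) • (volume : Measure (Euc n)) := by
  have h1 : (rescaleHomeo c hr.ne' : Euc n → Euc n) = (fun x => r⁻¹ • x) ∘ fun x => x - c := rfl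
  rw [h1, ← Measure.map_map (measurable_const_smul _) (measurable_sub_const c),
    (measurePreserving_sub_right volume c).map_eq,
    Measure.map_addHaar_smul volume (inv_ne_zero hr.ne')]
  simp [abs_of_pos hr]

theorem lintegral_rescale (c : Euc n) {r : ℝ} (hr : 0 < r) (φ : Euc n → ℝ≥0∞) :
    ∫⁻ x, φ (r⁻¹ • (x - c)) = ENNReal.ofReal (r ^ n) * ∫⁻ x, φ x := by
  have h := lintegral_map_equiv (μ := (volume : Measure (Euc n))) φ
    (rescaleHomeo c hr.ne').toMeasurableEquiv
  simp only [Homeomorph.toMeasurableEquiv_coe, map_rescaleHomeo c hr, lintegral_smul_measure,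
    rescaleHomeo_apply, smul_eq_mul] at h
  exact h.symm

theorem integral_rescale {V : Type*} [NormedAddCommGroup V] [NormedSpace ℝ V]
    (c : Euc n) {r : ℝ} (hr : 0 < r) (φ : Euc n → V) :
    ∫ x, φ (r⁻¹ • (x - c)) = r ^ n • ∫ x, φ x := by
  have h := integral_map_equiv (μ := (volume : Measure (Euc n)))
    (rescaleHomeo c hr.ne').toMeasurableEquiv φ
  simp only [Homeomorph.toMeasurableEquiv_coe, map_rescaleHomeo c hr, integral_smul_measure,
    rescaleHomeo_apply] at h
  rw [← h, ENNReal.toReal_ofReal (by positivity)]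

theorem measure_preimage_rescale (c : Euc n) {r : ℝ} (hr : 0 < r) (s : Set (Euc n)) :
    volume ((fun x => r⁻¹ • (x - c)) ⁻¹' s) = ENNReal.ofReal (r ^ n) * volume s := by
  have h := (rescaleHomeo c hr.ne').toMeasurableEquiv.map_apply (μ := (volume : Measure (Euc n))) s
  simp only [Homeomorph.toMeasurableEquiv_coe, map_rescaleHomeo c hr] at h
  exact h.symm

theorem quasiMeasurePreserving_rescale (c : Euc n) {r : ℝ} (hr : 0 < r) :
    Measure.QuasiMeasurePreserving (fun x : Euc n => r⁻¹ • (x - c)) volume volume := by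
  refine ⟨(rescaleHomeo c hr.ne').continuous.measurable, ?_⟩
  have := map_rescaleHomeo c hr
  change Measure.map (rescaleHomeo c hr.ne') volume ≪ _
  rw [this]
  exact Measure.smul_absolutelyContinuous

theorem locallyIntegrable_rescale {V : Type*} [NormedAddCommGroup V]
    (c : Euc n) {r : ℝ} (hr : 0 < r) {u : Euc n → V} (hu : LocallyIntegrable u) :
    LocallyIntegrable (fun x => u (r⁻¹ • (x - c))) := by
  have h : LocallyIntegrable u (Measure.map (rescaleHomeo c hr.ne') volume) := by
    rw [map_rescaleHomeo c hr]
    intro x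
    obtain ⟨s, hs, h⟩ := hu x
    refine ⟨s, hs, ?_⟩
    rw [IntegrableOn, Measure.restrict_smul]
    exact h.smul_measure ENNReal.ofReal_ne_top
  exact (locallyIntegrable_map_homeomorph _).1 h

theorem mem_ball_iff_rescale {c : Euc n} {r : ℝ} (hr : 0 < r) {x : Euc n} :
    r⁻¹ • (x - c) ∈ ball (0 : Euc n) 1 ↔ x ∈ ball c r := by
  rw [mem_ball_zero_iff, norm_smul, mem_ball_iff_norm, norm_inv, Real.norm_of_nonneg hr.le,
    inv_mul_lt_iff₀ hr, mul_one]

end Rescale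

/-! ### Series in `L^p` -/

/-- Absolute convergence in the Banach space `Lp` gives a sum there, and this sum agrees a.e. with
the pointwise series. -/
theorem memLp_tsum {X V ι : Type*} [MeasurableSpace X] {μ : Measure X} [NormedAddCommGroup V]
    [CompleteSpace V] [Countable ι] {p : ℝ≥0∞} (hp : 1 ≤ p) {f : ι → X → V}
    (hf : ∀ i, AEStronglyMeasurable (f i) μ) (h : ∑' i, eLpNorm (f i) p μ ≠ ⊤) :
    MemLp (fun x => ∑' i, f i x) p μ := by
  have : Fact (1 ≤ p) := ⟨hp⟩
  have hm : ∀ i, MemLp (f i) p μ := fun i =>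
    ⟨hf i, lt_of_le_of_lt (ENNReal.le_tsum i) h.lt_top⟩
  let F : ι → Lp V p μ := fun i => (hm i).toLp (f i)
  have hF : ∑' i, ‖F i‖ₑ ≠ ⊤ := by
    simpa [F, Lp.enorm_def, eLpNorm_congr_ae (hm _).coeFn_toLp] using h
  have h1 := Lp.coeFn_tsum hF
  have h2 : ∀ᵐ x ∂μ, ∀ i, F i x = f i x := ae_all_iff.2 fun i => (hm i).coeFn_toLp
  refine (memLp_congr_ae ?_).1 (Lp.memLp (∑' i, F i))
  filter_upwards [h1, h2] with x hx1 hx2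
  rw [hx1]
  simp [hx2]

/-! ### Weak derivatives on `ℝⁿ` -/

section WeakDeriv

variable {n : ℕ}

/-- Allows the whole construction to live on `ℝⁿ`: test functions supported in `Ω` do not see the
complement. -/
theorem IsWeakDerivOn.restrict {u : Euc n → Euc n} {g : Euc n → (Euc n →L[ℝ] Euc n)}
    (h : IsWeakDerivOn univ u g) (Ω : Set (Euc n)) : IsWeakDerivOn Ω u g := by
  obtain ⟨h1, h2, h3⟩ := h
  refine ⟨h1.mono_set (subset_univ _), h2.mono_set (subset_univ _), fun φ hφ hc hs v => ?_⟩
  have h := h3 φ hφ hc (subset_univ _) v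
  rw [setIntegral_univ, setIntegral_univ] at h
  rw [setIntegral_eq_integral_of_forall_compl_eq_zero, h,
    setIntegral_eq_integral_of_forall_compl_eq_zero]
  · intro x hx
    rw [image_eq_zero_of_notMem_tsupport fun h => hx (hs h), zero_smul]
  · intro x hx
    have : fderiv ℝ φ x = 0 := by
      apply image_eq_zero_of_notMem_tsupport
      exact fun h => hx (hs (tsupport_fderiv_subset ℝ h))
    simp [this]

theorem integrable_test_smul {V : Type*} [NormedAddCommGroup V] [NormedSpace ℝ V]
    {φ : Euc n → ℝ} (hφ : Continuous φ) (hc : HasCompactSupport φ)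
    {u : Euc n → V} (hu : LocallyIntegrable u) : Integrable fun x => φ x • u x :=
  hu.integrable_smul_left_of_hasCompactSupport hφ hc

theorem continuous_fderiv_apply_of_contDiff {φ : Euc n → ℝ} (hφ : ContDiff ℝ ∞ φ) (v : Euc n) :
    Continuous fun x => fderiv ℝ φ x v :=
  (hφ.continuous_fderiv (by simp)).clm_apply continuous_const

theorem hasCompactSupport_fderiv_apply {φ : Euc n → ℝ} (hc : HasCompactSupport φ) (v : Euc n) :
    HasCompactSupport fun x => fderiv ℝ φ x v :=
  hc.fderiv_apply ℝ v

theorem locallyIntegrable_clm_apply {g : Euc n → (Euc n →L[ℝ] Euc n)}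
    (hg : LocallyIntegrable g) (v : Euc n) : LocallyIntegrable fun x => g x v := by
  intro x
  obtain ⟨s, hs, h⟩ := hg x
  exact ⟨s, hs, (ContinuousLinearMap.apply ℝ (Euc n) v).integrable_comp h⟩

theorem locallyIntegrable_add {V : Type*} [NormedAddCommGroup V] {u u' : Euc n → V}
    (hu : LocallyIntegrable u) (hu' : LocallyIntegrable u') :
    LocallyIntegrable fun x => u x + u' x := by
  intro x
  obtain ⟨s, hs, h⟩ := hu x
  obtain ⟨s', hs', h'⟩ := hu' x
  exact ⟨s ∩ s', inter_mem hs hs', Integrable.add (h.mono_set inter_subset_left)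
    (h'.mono_set inter_subset_right)⟩

theorem IsWeakDerivOn.add {u u' : Euc n → Euc n} {g g' : Euc n → (Euc n →L[ℝ] Euc n)}
    (h : IsWeakDerivOn univ u g) (h' : IsWeakDerivOn univ u' g') :
    IsWeakDerivOn univ (fun x => u x + u' x) (fun x => g x + g' x) := by
  obtain ⟨h1, h2, h3⟩ := h
  obtain ⟨h1', h2', h3'⟩ := h'
  refine ⟨locallyIntegrableOn_univ.2 (locallyIntegrable_add
    (locallyIntegrableOn_univ.1 h1) (locallyIntegrableOn_univ.1 h1')),
    locallyIntegrableOn_univ.2 (locallyIntegrable_add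
    (locallyIntegrableOn_univ.1 h2) (locallyIntegrableOn_univ.1 h2')),
    fun φ hφ hc hs v => ?_⟩
  have e := h3 φ hφ hc hs v
  have e' := h3' φ hφ hc hs v
  simp only [setIntegral_univ, locallyIntegrableOn_univ] at *
  have c1 := continuous_fderiv_apply_of_contDiff hφ v
  have c2 := hasCompactSupport_fderiv_apply hc v
  simp only [smul_add, add_apply]
  rw [integral_add (integrable_test_smul c1 c2 h1) (integrable_test_smul c1 c2 h1'),
    integral_add (integrable_test_smul hφ.continuous hc (locallyIntegrable_clm_apply h2 v))
    (integrable_test_smul hφ.continuous hc (locallyIntegrable_clm_apply h2' v)), e, e', neg_add]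

theorem IsWeakDerivOn.rescale {u : Euc n → Euc n} {g : Euc n → (Euc n →L[ℝ] Euc n)}
    (h : IsWeakDerivOn univ u g) (c : Euc n) {r : ℝ} (hr : 0 < r) (s : ℝ) :
    IsWeakDerivOn univ (fun x => s • u (r⁻¹ • (x - c)))
      (fun x => (s * r⁻¹) • g (r⁻¹ • (x - c))) := by
  obtain ⟨h1, h2, h3⟩ := h
  simp only [setIntegral_univ, locallyIntegrableOn_univ, IsWeakDerivOn] at *
  refine ⟨(locallyIntegrable_rescale c hr h1).smul s,
    (locallyIntegrable_rescale c hr h2).smul (s * r⁻¹), fun φ hφ hc hs v => ?_⟩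
  have hid : ∀ x, c + r • (r⁻¹ • (x - c)) = x := fun x => by
    rw [smul_smul, mul_inv_cancel₀ hr.ne', one_smul, add_sub_cancel]
  have hψ : ContDiff ℝ ∞ fun y => φ (c + r • y) := by fun_prop
  have hψc : HasCompactSupport fun y => φ (c + r • y) :=
    hc.comp_homeomorph ((Homeomorph.smulOfNeZero r hr.ne').trans (Homeomorph.addLeft c))
  have key := h3 _ hψ hψc (subset_univ _) v
  have hd : ∀ y, fderiv ℝ (fun y => φ (c + r • y)) y v = r * fderiv ℝ φ (c + r • y) v := by
    intro y
    have h0 : HasFDerivAt (fun y : Euc n => c + r • y)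
        (r • ContinuousLinearMap.id ℝ (Euc n)) y :=
      ((hasFDerivAt_id y).const_smul r).const_add c
    have h1 := ((hφ.differentiable (by simp)) (c + r • y)).hasFDerivAt.comp y h0
    rw [show (fun y => φ (c + r • y)) = φ ∘ fun y => c + r • y from rfl, h1.fderiv]
    simp
  have e1 : ∀ x, (fderiv ℝ φ x v) • s • u (r⁻¹ • (x - c)) =
      (fun y => (s * r⁻¹) • ((fderiv ℝ (fun y => φ (c + r • y)) y v) • u y))
        (r⁻¹ • (x - c)) := by
    intro x
    simp only [hd]
    rw [hid, smul_smul, smul_smul]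
    congr 1
    field_simp
  have e2 : ∀ x, φ x • ((s * r⁻¹) • g (r⁻¹ • (x - c))) v =
      (fun y => (s * r⁻¹) • (φ (c + r • y) • g y v)) (r⁻¹ • (x - c)) := by
    intro x
    simp only [hid, smul_apply]
    rw [smul_comm]
  have i1 := integral_rescale c hr fun y =>
    (s * r⁻¹) • ((fderiv ℝ (fun y => φ (c + r • y)) y v) • u y)
  have i2 := integral_rescale c hr fun y => (s * r⁻¹) • (φ (c + r • y) • g y v)
  rw [integral_congr_ae (.of_forall e1), integral_congr_ae (.of_forall e2)]
  refine i1.trans ?_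
  rw [i2, integral_smul, integral_smul, key]
  simp

/-- A test function and its derivative are bounded, so `L^1` summability allows integral and sum to
be exchanged on both sides of the defining identity. -/
theorem IsWeakDerivOn.tsum {ι : Type*} [Countable ι] {u : ι → Euc n → Euc n}
    {g : ι → Euc n → (Euc n →L[ℝ] Euc n)} (h : ∀ i, IsWeakDerivOn univ (u i) (g i))
    (hu : ∑' i, eLpNorm (u i) 1 volume ≠ ⊤) (hg : ∑' i, eLpNorm (g i) 1 volume ≠ ⊤) :
    IsWeakDerivOn univ (fun x => ∑' i, u i x) (fun x => ∑' i, g i x) := by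
  have hum : ∀ i, AEStronglyMeasurable (u i) volume := fun i =>
    (locallyIntegrableOn_univ.1 (h i).1).aestronglyMeasurable
  have hgm : ∀ i, AEStronglyMeasurable (g i) volume := fun i =>
    (locallyIntegrableOn_univ.1 (h i).2.1).aestronglyMeasurable
  have bound : ∀ {V : Type} [NormedAddCommGroup V] [NormedSpace ℝ V] (w : ι → Euc n → V)
      (φ : Euc n → ℝ), Continuous φ → HasCompactSupport φ →
      ∑' i, eLpNorm (w i) 1 volume ≠ ⊤ → ∑' i, ∫⁻ x, ‖φ x • w i x‖ₑ ≠ ⊤ := by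
    intro V _ _ w φ hφ hc hw
    obtain ⟨C, hC⟩ := hc.exists_bound_of_continuous hφ
    refine ne_top_of_le_ne_top (ENNReal.mul_ne_top (ENNReal.ofReal_ne_top (r := C)) hw) ?_
    rw [← ENNReal.tsum_mul_left]
    refine ENNReal.tsum_le_tsum fun i => ?_
    rw [eLpNorm_one_eq_lintegral_enorm, ← lintegral_const_mul' _ _ ENNReal.ofReal_ne_top]
    refine lintegral_mono fun x => ?_
    rw [enorm_smul]
    gcongr
    rw [← ofReal_norm]
    exact ENNReal.ofReal_le_ofReal (hC x)
  refine ⟨?_, ?_, fun φ hφ hc _ v => ?_⟩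
  · exact locallyIntegrableOn_univ.2
      (memLp_one_iff_integrable.1 (memLp_tsum le_rfl hum hu)).locallyIntegrable
  · exact locallyIntegrableOn_univ.2
      (memLp_one_iff_integrable.1 (memLp_tsum le_rfl hgm hg)).locallyIntegrable
  have c1 := continuous_fderiv_apply_of_contDiff hφ v
  have c2 := hasCompactSupport_fderiv_apply hc v
  have hsum := summable_norm_of_tsum_eLpNorm_ne_top le_rfl hgm hg
  have e1 : ∫ x, (fderiv ℝ φ x v) • ∑' i, u i x = ∑' i, ∫ x, (fderiv ℝ φ x v) • u i x := by
    simp_rw [← tsum_const_smul'']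
    exact integral_tsum (fun i => c1.aestronglyMeasurable.smul (hum i)) (bound _ _ c1 c2 hu)
  have e2 : ∫ x, φ x • (∑' i, g i x) v = ∑' i, ∫ x, φ x • g i x v := by
    have : ∀ᵐ x, φ x • (∑' i, g i x) v = ∑' i, φ x • g i x v := by
      filter_upwards [hsum] with x hx
      rw [tsum_const_smul'']
      congr 1
      exact (ContinuousLinearMap.apply ℝ (Euc n) v).map_tsum hx.of_norm
    rw [integral_congr_ae this]
    refine integral_tsum (fun i => hφ.continuous.aestronglyMeasurable.smul
      ((ContinuousLinearMap.apply ℝ (Euc n) v).continuous.comp_aestronglyMeasurable (hgm i))) ?_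
    refine bound _ _ hφ.continuous hc ?_
    refine ne_top_of_le_ne_top (ENNReal.mul_ne_top (enorm_ne_top (x := v)) hg) ?_
    rw [← ENNReal.tsum_mul_left]
    refine ENNReal.tsum_le_tsum fun i => ?_
    rw [eLpNorm_one_eq_lintegral_enorm, eLpNorm_one_eq_lintegral_enorm,
      ← lintegral_const_mul' _ _ enorm_ne_top]
    refine lintegral_mono fun x => ?_
    rw [mul_comm]
    exact (g i x).le_opENorm v
  simp only [setIntegral_univ]
  rw [e1, e2, ← tsum_neg]
  congr 1
  ext1 i
  have := (h i).2.2 φ hφ hc (subset_univ _) v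
  simpa only [setIntegral_univ] using this

/-- Coordinate by coordinate this is integration by parts for a product of Lipschitz functions, one
of them compactly supported. -/
theorem isWeakDerivOn_of_lipschitzWith {C : NNReal} {f : Euc n → Euc n}
    {g : Euc n → (Euc n →L[ℝ] Euc n)} (hf : LipschitzWith C f)
    (hg : AEStronglyMeasurable g volume) (hfg : ∀ᵐ x, HasFDerivAt f (g x) x) :
    IsWeakDerivOn univ f g := by
  have hfl : LocallyIntegrable f volume := hf.continuous.locallyIntegrable
  have hgl : LocallyIntegrable g volume := by
    have : MemLp g ⊤ volume := memLp_top_of_bound hg C <| by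
      filter_upwards [hfg] with x hx using hx.le_of_lipschitz hf
    exact this.locallyIntegrable le_top
  refine ⟨locallyIntegrableOn_univ.2 hfl, locallyIntegrableOn_univ.2 hgl,
    fun φ hφ hc _ v => ?_⟩
  simp only [setIntegral_univ]
  have c1 := continuous_fderiv_apply_of_contDiff hφ v
  have c2 := hasCompactSupport_fderiv_apply hc v
  have i1 := integrable_test_smul c1 c2 hfl
  have i2 := integrable_test_smul hφ.continuous hc (locallyIntegrable_clm_apply hgl v)
  obtain ⟨D, hD⟩ : ∃ D, LipschitzWith D φ :=
    ContDiff.lipschitzWith_of_hasCompactSupport hc hφ (by simp)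
  ext i
  let π : Euc n →L[ℝ] ℝ := EuclideanSpace.proj i
  have hfi : LipschitzWith (‖π‖₊ * C) fun x => π (f x) := π.lipschitz.comp hf
  have key := hfi.integral_lineDeriv_mul_eq (μ := volume) hD hc v
  have a1 : ∫ x, lineDeriv ℝ (fun x => π (f x)) x v * φ x = π (∫ x, φ x • g x v) := by
    rw [← π.integral_comp_comm i2]
    refine integral_congr_ae ?_
    filter_upwards [hfg] with x hx
    have hx' : HasFDerivAt (fun x => π (f x)) (π.comp (g x)) x := π.hasFDerivAt.comp x hx
    rw [hx'.differentiableAt.lineDeriv_eq_fderiv, hx'.fderiv]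
    simp [mul_comm]
  have a2 : ∫ x, lineDeriv ℝ φ x (-v) * π (f x) = - π (∫ x, fderiv ℝ φ x v • f x) := by
    rw [← π.integral_comp_comm i1, ← integral_neg]
    congr 1
    ext1 x
    rw [(hφ.differentiable (by simp)).differentiableAt.lineDeriv_eq_fderiv]
    simp
  rw [a1, a2] at key
  change π (∫ x, fderiv ℝ φ x v • f x) = π (-∫ x, φ x • g x v)
  rw [map_neg, key, neg_neg]

end WeakDeriv

/-! ### Truncated radial stretchings -/

section RadialStretch

variable {n : ℕ}

/-- The radial stretching `x ↦ |x|⁻ᵇ x`, replaced by a dilation on the ball of radius `t`. -/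
noncomputable def radialStretch (b t : ℝ) (x : Euc n) : Euc n :=
  (max ‖x‖ t) ^ (-b) • x

/-- The derivative of `radialStretch b t` off the sphere of radius `t`. -/
noncomputable def radialStretchDeriv (b t : ℝ) (x : Euc n) : Euc n →L[ℝ] Euc n :=
  if ‖x‖ < t then t ^ (-b) • ContinuousLinearMap.id ℝ (Euc n)
  else ‖x‖ ^ (-b) • (ContinuousLinearMap.id ℝ (Euc n) -
    (b / ‖x‖ ^ 2) • (innerSL ℝ x).smulRight x)

theorem radialStretch_of_le {b t : ℝ} {x : Euc n} (h : ‖x‖ ≤ t) :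
    radialStretch b t x = t ^ (-b) • x := by
  rw [radialStretch, max_eq_right h]

theorem radialStretch_of_ge {b t : ℝ} {x : Euc n} (h : t ≤ ‖x‖) :
    radialStretch b t x = ‖x‖ ^ (-b) • x := by
  rw [radialStretch, max_eq_left h]

theorem radialStretchDeriv_of_lt {b t : ℝ} {x : Euc n} (h : ‖x‖ < t) :
    radialStretchDeriv b t x = t ^ (-b) • ContinuousLinearMap.id ℝ (Euc n) :=
  if_pos h

theorem radialStretchDeriv_of_ge {b t : ℝ} {x : Euc n} (h : t ≤ ‖x‖) :
    radialStretchDeriv b t x = ‖x‖ ^ (-b) • (ContinuousLinearMap.id ℝ (Euc n) -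
      (b / ‖x‖ ^ 2) • (innerSL ℝ x).smulRight x) :=
  if_neg h.not_gt

/-- Bernoulli's inequality for `(s / s')^b`. It controls the change of the radial factor in the
Lipschitz estimate for `radialStretch`. -/
theorem rpow_neg_sub_rpow_neg_mul_le {b s s' : ℝ} (hb : 1 ≤ b) (hs : 0 < s) (hss' : s ≤ s') :
    (s ^ (-b) - s' ^ (-b)) * s' ≤ b * s ^ (-b) * (s' - s) := by
  have hs' : 0 < s' := hs.trans_le hss'
  have h := one_add_mul_self_le_rpow_one_add (s := s / s' - 1) (p := b)
    (by linarith [div_nonneg hs.le hs'.le]) hb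
  rw [add_sub_cancel, Real.div_rpow hs.le hs'.le] at h
  have e : s' ^ (-b) = s ^ (-b) * (s ^ b / s' ^ b) := by
    rw [Real.rpow_neg hs'.le, Real.rpow_neg hs.le]
    have := (Real.rpow_pos_of_pos hs b).ne'
    field_simp
  have hp := Real.rpow_pos_of_pos hs (-b)
  rw [e]
  calc (s ^ (-b) - s ^ (-b) * (s ^ b / s' ^ b)) * s'
      = s ^ (-b) * (s' * (1 - s ^ b / s' ^ b)) := by ring
    _ ≤ s ^ (-b) * (s' * (1 - (1 + b * (s / s' - 1)))) := by gcongr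
    _ = b * s ^ (-b) * (s' - s) := by field_simp; ring

theorem norm_radialStretch_sub_le {b t : ℝ} (hb : 1 ≤ b) (ht : 0 < t) {x y : Euc n}
    (hxy : ‖x‖ ≤ ‖y‖) :
    ‖radialStretch b t x - radialStretch b t y‖ ≤ (b + 1) * t ^ (-b) * ‖x - y‖ := by
  have e : radialStretch b t x - radialStretch b t y =
      ((max ‖x‖ t) ^ (-b) - (max ‖y‖ t) ^ (-b)) • x + (max ‖y‖ t) ^ (-b) • (x - y) := by
    simp only [radialStretch]; module
  have hx : 0 < max ‖x‖ t := lt_max_of_lt_right ht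
  have hmm : max ‖x‖ t ≤ max ‖y‖ t := max_le_max_right t hxy
  have h1 := rpow_neg_sub_rpow_neg_mul_le hb hx hmm
  have h2 : (max ‖x‖ t) ^ (-b) ≤ t ^ (-b) :=
    Real.rpow_le_rpow_of_nonpos ht (le_max_right _ _) (by linarith)
  have h3 : (max ‖y‖ t) ^ (-b) ≤ (max ‖x‖ t) ^ (-b) :=
    Real.rpow_le_rpow_of_nonpos hx hmm (by linarith)
  have h4 : max ‖y‖ t - max ‖x‖ t ≤ ‖x - y‖ := by
    have := abs_max_sub_max_le_abs ‖y‖ ‖x‖ t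
    have h5 := abs_norm_sub_norm_le y x
    rw [norm_sub_rev] at h5
    exact (le_abs_self _).trans (this.trans h5)
  have h6 : 0 ≤ (max ‖y‖ t) ^ (-b) := by positivity
  have h7 : 0 ≤ max ‖y‖ t - max ‖x‖ t := sub_nonneg.2 hmm
  rw [e]
  refine (norm_add_le _ _).trans ?_
  rw [norm_smul, norm_smul, Real.norm_of_nonneg (sub_nonneg.2 h3), Real.norm_of_nonneg h6]
  calc _ ≤ ((max ‖x‖ t) ^ (-b) - (max ‖y‖ t) ^ (-b)) * max ‖y‖ t
        + (max ‖y‖ t) ^ (-b) * ‖x - y‖ := by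
        have := sub_nonneg.2 h3
        gcongr
        exact hxy.trans (le_max_left _ _)
    _ ≤ b * t ^ (-b) * ‖x - y‖ + t ^ (-b) * ‖x - y‖ := by
        refine add_le_add (h1.trans ?_) ?_
        · gcongr
        · exact mul_le_mul_of_nonneg_right (h3.trans h2) (norm_nonneg _)
    _ = _ := by ring

theorem exists_lipschitzWith_radialStretch {b t : ℝ} (hb : 1 ≤ b) (ht : 0 < t) :
    ∃ C : NNReal, LipschitzWith C (radialStretch b t : Euc n → Euc n) := by
  refine ⟨((b + 1) * t ^ (-b)).toNNReal, LipschitzWith.of_dist_le_mul fun x y => ?_⟩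
  rw [Real.coe_toNNReal _ (by positivity), dist_eq_norm, dist_eq_norm]
  rcases le_total ‖x‖ ‖y‖ with h | h
  · exact norm_radialStretch_sub_le hb ht h
  · rw [norm_sub_rev, norm_sub_rev x]
    exact norm_radialStretch_sub_le hb ht h

theorem hasFDerivAt_radialStretch {b t : ℝ} (ht : 0 < t) {x : Euc n} (hx : ‖x‖ ≠ t) :
    HasFDerivAt (radialStretch b t) (radialStretchDeriv b t x) x := by
  rcases hx.lt_or_gt with h | h
  · rw [radialStretchDeriv_of_lt h]
    refine ((hasFDerivAt_id x).const_smul (t ^ (-b))).congr_of_eventuallyEq ?_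
    filter_upwards [(isOpen_lt continuous_norm continuous_const).mem_nhds h] with y hy
    exact radialStretch_of_le (le_of_lt hy)
  · rw [radialStretchDeriv_of_ge h.le]
    have hx0 : 0 < ‖x‖ := ht.trans h
    have h1 : HasFDerivAt (fun y : Euc n => (‖y‖ ^ 2) ^ (-b / 2)) _ x :=
      (hasStrictFDerivAt_norm_sq x).hasFDerivAt.rpow_const (Or.inl (by positivity))
    have h2 := h1.smul (hasFDerivAt_id x)
    have hev : radialStretch b t =ᶠ[𝓝 x] fun y => (‖y‖ ^ 2) ^ (-b / 2) • id y := by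
      filter_upwards [(isOpen_lt continuous_const continuous_norm).mem_nhds h] with y hy
      rw [radialStretch_of_ge (le_of_lt hy), ← Real.rpow_natCast, ← Real.rpow_mul (norm_nonneg _)]
      congr 2
      push_cast
      ring
    refine (h2.congr_of_eventuallyEq hev).congr_fderiv ?_
    have e1 : (‖x‖ ^ 2) ^ (-b / 2) = ‖x‖ ^ (-b) := by
      rw [← Real.rpow_natCast, ← Real.rpow_mul (norm_nonneg _)]
      congr 1
      push_cast
      ring
    have e2 : (‖x‖ ^ 2) ^ (-b / 2 - 1) = ‖x‖ ^ (-b) / ‖x‖ ^ 2 := by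
      rw [Real.rpow_sub_one (by positivity), e1]
    ext1 v
    simp only [e1, e2, id, smul_sub, ContinuousLinearMap.smulRight_apply, sub_apply, add_apply,
      smul_apply, ContinuousLinearMap.id_apply, innerSL_apply_apply, smul_smul, smul_eq_mul,
      nsmul_eq_mul]
    rw [sub_eq_add_neg, ← neg_smul]
    congr 2
    push_cast
    ring

theorem measurable_radialStretchDeriv (b t : ℝ) :
    Measurable (radialStretchDeriv b t : Euc n → (Euc n →L[ℝ] Euc n)) := by
  refine Measurable.ite (measurableSet_lt measurable_norm measurable_const) measurable_const ?_
  have h1 : Measurable fun x : Euc n => ‖x‖ ^ (-b) := by fun_prop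
  have h2 : Measurable fun x : Euc n => b / ‖x‖ ^ 2 := by fun_prop
  have h3 : Continuous fun x : Euc n => (innerSL ℝ x).smulRight x := by fun_prop
  exact h1.smul (measurable_const.sub (h2.smul h3.measurable))

theorem ae_norm_ne (t : ℝ) (ht : t ≠ 0) : ∀ᵐ x : Euc n, ‖x‖ ≠ t := by
  have := Measure.addHaar_sphere_of_ne_zero (volume : Measure (Euc n)) 0 ht
  rw [ae_iff]
  convert! this using 2
  ext x
  simp

theorem ae_hasFDerivAt_radialStretch {b t : ℝ} (ht : 0 < t) :
    ∀ᵐ x : Euc n, HasFDerivAt (radialStretch b t) (radialStretchDeriv b t x) x := by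
  filter_upwards [ae_norm_ne t ht.ne'] with x hx using hasFDerivAt_radialStretch ht hx

/-- The pointwise condition in the definition of a weakly `K`-quasiregular map with nonpositive
Jacobian. -/
def IsReversingQuasiconformal (K : ℝ) (L : Euc n →L[ℝ] Euc n) : Prop :=
  L.det ≤ 0 ∧ ∀ ξ η : Euc n, ‖ξ‖ = 1 → ‖η‖ = 1 → ‖L ξ‖ ≤ K * ‖L η‖

theorem IsReversingQuasiconformal.smul {K s : ℝ} (hs : 0 ≤ s) {L : Euc n →L[ℝ] Euc n}
    (h : IsReversingQuasiconformal K L) : IsReversingQuasiconformal K (s • L) := by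
  refine ⟨?_, fun ξ η hξ hη => ?_⟩
  · have : (s • L).det = s ^ Module.finrank ℝ (Euc n) * L.det := by
      simp only [ContinuousLinearMap.det, ContinuousLinearMap.toLinearMap_smul,
        LinearMap.det_smul]
    rw [this]
    exact mul_nonpos_of_nonneg_of_nonpos (by positivity) h.1
  · simp only [smul_apply, norm_smul]
    nlinarith [h.2 ξ η hξ hη, norm_nonneg s]

/-- Up to a positive factor the derivative is `I - b e⊗e` with `e = x/|x|`, a rank-one perturbation
of determinant `1 - b < 0`. On a unit vector at angle `θ` to `x` its squared length is `(1 - c) + (b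
- 1)^2 c` with `c = cos² θ`, so only the extremes `1` and `(b - 1)^2` have to be compared. -/
theorem isReversingQuasiconformal_radialStretchDeriv {b t K : ℝ} (hb : 1 < b)
    (hK : b - 1 ≤ K) (hK' : 1 ≤ K * (b - 1)) (ht : 0 < t) {x : Euc n} (hx : t ≤ ‖x‖) :
    IsReversingQuasiconformal K (radialStretchDeriv b t x) := by
  rw [radialStretchDeriv_of_ge hx]
  have hx0 : 0 < ‖x‖ := ht.trans_le hx
  refine IsReversingQuasiconformal.smul (by positivity) ⟨?_, fun ξ η hξ hη => ?_⟩
  · have : ((ContinuousLinearMap.id ℝ (Euc n) - (b / ‖x‖ ^ 2) • (innerSL ℝ x).smulRight x :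
        Euc n →L[ℝ] Euc n) : Euc n →ₗ[ℝ] Euc n) =
        LinearMap.transvection ((-(b / ‖x‖ ^ 2)) • (innerSL ℝ x : Euc n →ₗ[ℝ] ℝ)) x := by
      ext1 v
      simp [LinearMap.transvection.apply, sub_eq_add_neg, smul_smul]
    rw [ContinuousLinearMap.det, this, LinearMap.transvection.det]
    simp only [LinearMap.smul_apply, ContinuousLinearMap.coe_coe, innerSL_apply_apply,
      real_inner_self_eq_norm_sq, smul_eq_mul]
    field_simp
    linarith
  · have key : ∀ ζ : Euc n, ‖ζ‖ = 1 → ∃ c, 0 ≤ c ∧ c ≤ 1 ∧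
        ‖(ContinuousLinearMap.id ℝ (Euc n) - (b / ‖x‖ ^ 2) • (innerSL ℝ x).smulRight x :
        Euc n →L[ℝ] Euc n) ζ‖ ^ 2 = (1 - c) + (b - 1) ^ 2 * c := by
      intro ζ hζ
      refine ⟨(inner ℝ x ζ / ‖x‖) ^ 2, by positivity, ?_, ?_⟩
      · rw [sq_le_one_iff_abs_le_one, abs_div, abs_norm, div_le_one hx0]
        simpa [hζ] using abs_real_inner_le_norm x ζ
      · simp only [sub_apply, smul_apply, ContinuousLinearMap.id_apply,
          ContinuousLinearMap.smulRight_apply, innerSL_apply_apply, smul_smul]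
        rw [norm_sub_sq_real, norm_smul, inner_smul_right, real_inner_comm, hζ, mul_pow,
          Real.norm_eq_abs, sq_abs]
        field_simp
        ring
    obtain ⟨c, hc0, hc1, hc⟩ := key ξ hξ
    obtain ⟨c', hc0', hc1', hc'⟩ := key η hη
    have hK0 : 0 < K := by nlinarith
    refine le_of_sq_le_sq ?_ (by positivity)
    rw [mul_pow, hc, hc']
    have k1 : 1 ≤ K ^ 2 := by nlinarith
    have k2 : 1 ≤ K ^ 2 * (b - 1) ^ 2 := by nlinarith
    have k3 : (b - 1) ^ 2 ≤ K ^ 2 := by nlinarith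
    have k4 : (b - 1) ^ 2 ≤ K ^ 2 * (b - 1) ^ 2 := by nlinarith [sq_nonneg (b - 1)]
    have m1 : 1 ≤ K ^ 2 * (1 - c' + (b - 1) ^ 2 * c') := by
      nlinarith [mul_nonneg hc0' (sub_nonneg.2 k2), mul_nonneg (sub_nonneg.2 hc1') (sub_nonneg.2 k1)]
    have m2 : (b - 1) ^ 2 ≤ K ^ 2 * (1 - c' + (b - 1) ^ 2 * c') := by
      nlinarith [mul_nonneg hc0' (sub_nonneg.2 k4), mul_nonneg (sub_nonneg.2 hc1') (sub_nonneg.2 k3)]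
    nlinarith [mul_nonneg hc0 (sub_nonneg.2 m2), mul_nonneg (sub_nonneg.2 hc1) (sub_nonneg.2 m1)]

end RadialStretch

/-! ### Packings of a ball by balls and the transfer operator -/

/-- A family of disjoint balls in the ball of radius `t` about the origin which covers almost all
of it. -/
structure BallPacking (n : ℕ) (t : ℝ) (ι : Type*) where
  /-- The centers of the balls. -/
  c : ι → Euc n
  /-- The radii of the balls. -/
  r : ι → ℝ
  r_pos : ∀ i, 0 < r i
  ball_subset : ∀ i, ball (c i) (r i) ⊆ ball 0 t
  disjoint : Pairwise fun i j => Disjoint (ball (c i) (r i)) (ball (c j) (r j))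
  measure_diff : volume (ball (0 : Euc n) t \ ⋃ i, ball (c i) (r i)) = 0

namespace BallPacking

variable {n : ℕ} {t : ℝ} {ι : Type*} (P : BallPacking n t ι)
  {V : Type*} [NormedAddCommGroup V] [NormedSpace ℝ V]

/-- The sum of the copies of `u`, multiplied by `s i`, placed in the balls of a packing. -/
noncomputable def transfer (s : ι → ℝ) (u : Euc n → V) (x : Euc n) : V :=
  ∑' i, s i • u ((P.r i)⁻¹ • (x - P.c i))

variable {P} {s : ι → ℝ} {u : Euc n → V}

theorem term_eq_zero (hu : ∀ x ∉ ball (0 : Euc n) 1, u x = 0) {i : ι} {x : Euc n}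
    (hx : x ∉ ball (P.c i) (P.r i)) : s i • u ((P.r i)⁻¹ • (x - P.c i)) = 0 := by
  rw [hu _ (fun h => hx ((mem_ball_iff_rescale (P.r_pos i)).1 h)), smul_zero]

theorem transfer_of_mem (hu : ∀ x ∉ ball (0 : Euc n) 1, u x = 0) {i : ι} {x : Euc n}
    (hx : x ∈ ball (P.c i) (P.r i)) :
    P.transfer s u x = s i • u ((P.r i)⁻¹ • (x - P.c i)) :=
  tsum_eq_single i fun _ hj =>
    term_eq_zero hu fun h => (disjoint_left.1 (P.disjoint hj)) h hx

theorem transfer_of_notMem (hu : ∀ x ∉ ball (0 : Euc n) 1, u x = 0) {x : Euc n}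
    (hx : x ∉ ⋃ i, ball (P.c i) (P.r i)) : P.transfer s u x = 0 := by
  simp only [mem_iUnion, not_exists] at hx
  simp only [transfer]
  simp_rw [fun i => term_eq_zero (s := s) hu (hx i), tsum_zero]

theorem transfer_of_notMem_ball (hu : ∀ x ∉ ball (0 : Euc n) 1, u x = 0) {x : Euc n}
    (hx : x ∉ ball (0 : Euc n) t) : P.transfer s u x = 0 :=
  transfer_of_notMem hu fun h => hx (iUnion_subset P.ball_subset h)

variable (P)

/-- Compare volumes and cancel that of the unit ball. This is the source of the factor `t^n` in
every later estimate. -/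
theorem tsum_radius_pow_le [Countable ι] (ht : 0 < t) :
    ∑' i, ENNReal.ofReal (P.r i ^ n) ≤ ENNReal.ofReal (t ^ n) := by
  have h1 : ∑' i, volume (ball (P.c i) (P.r i)) ≤ volume (ball (0 : Euc n) t) := by
    rw [← measure_iUnion P.disjoint fun i => measurableSet_ball]
    exact measure_mono (iUnion_subset P.ball_subset)
  simp_rw [fun i => Measure.addHaar_ball_of_pos (volume : Measure (Euc n)) (P.c i) (P.r_pos i),
    Measure.addHaar_ball_of_pos (volume : Measure (Euc n)) 0 ht, ENNReal.tsum_mul_right,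
    finrank_euclideanSpace_fin] at h1
  exact (ENNReal.mul_le_mul_iff_left (measure_ball_pos _ _ one_pos).ne'
    measure_ball_lt_top.ne).1 h1

theorem radius_le [Countable ι] (hn : n ≠ 0) (ht : 0 < t) (i : ι) : P.r i ≤ t := by
  have h := (ENNReal.le_tsum i).trans (P.tsum_radius_pow_le ht)
  rw [ENNReal.ofReal_le_ofReal_iff (by positivity)] at h
  exact (pow_le_pow_iff_left₀ (P.r_pos i).le ht.le hn).1 h

variable {P}

theorem aestronglyMeasurable_term (hm : AEStronglyMeasurable u volume) (i : ι) :
    AEStronglyMeasurable (fun x => s i • u ((P.r i)⁻¹ • (x - P.c i))) volume :=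
  (hm.comp_quasiMeasurePreserving (quasiMeasurePreserving_rescale _ (P.r_pos i))).const_smul _

theorem lintegral_term_le {A : ℝ} (hs : ∀ i, |s i| ≤ A) {q : ℝ} (hq : 0 ≤ q) (i : ι) :
    ∫⁻ x, ‖s i • u ((P.r i)⁻¹ • (x - P.c i))‖ₑ ^ q ≤
      ENNReal.ofReal A ^ q * (∫⁻ x, ‖u x‖ₑ ^ q) * ENNReal.ofReal (P.r i ^ n) := by
  have h := lintegral_rescale (P.c i) (P.r_pos i) fun x => ‖u x‖ₑ ^ q
  rw [mul_assoc, mul_comm (∫⁻ x, ‖u x‖ₑ ^ q), ← h, ← lintegral_const_mul' _ _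
    (ENNReal.rpow_ne_top_of_nonneg hq ENNReal.ofReal_ne_top)]
  refine lintegral_mono fun x => ?_
  dsimp only
  rw [enorm_smul, ENNReal.mul_rpow_of_nonneg _ _ hq]
  gcongr
  rw [← ofReal_norm]
  exact ENNReal.ofReal_le_ofReal (hs i)

theorem tsum_lintegral_term_le [Countable ι] (ht : 0 < t) {A : ℝ} (hs : ∀ i, |s i| ≤ A) {q : ℝ}
    (hq : 0 ≤ q) :
    ∑' i, ∫⁻ x, ‖s i • u ((P.r i)⁻¹ • (x - P.c i))‖ₑ ^ q ≤
      ENNReal.ofReal A ^ q * ENNReal.ofReal (t ^ n) * ∫⁻ x, ‖u x‖ₑ ^ q := by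
  refine (ENNReal.tsum_le_tsum fun i => lintegral_term_le hs hq i).trans ?_
  rw [ENNReal.tsum_mul_left, mul_right_comm]
  gcongr
  exact P.tsum_radius_pow_le ht

theorem tsum_eLpNorm_one_term_le [Countable ι] (ht : 0 < t) {A : ℝ} (hs : ∀ i, |s i| ≤ A) :
    ∑' i, eLpNorm (fun x => s i • u ((P.r i)⁻¹ • (x - P.c i))) 1 volume ≤
      ENNReal.ofReal A * ENNReal.ofReal (t ^ n) * eLpNorm u 1 volume := by
  have := tsum_lintegral_term_le (P := P) (u := u) ht hs (q := 1) zero_le_one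
  simpa only [ENNReal.rpow_one, eLpNorm_one_eq_lintegral_enorm] using this

theorem tsum_eLpNorm_one_term_ne_top [Countable ι] (ht : 0 < t) {A : ℝ} (hs : ∀ i, |s i| ≤ A)
    (hu : MemLp u 1 volume) :
    ∑' i, eLpNorm (fun x => s i • u ((P.r i)⁻¹ • (x - P.c i))) 1 volume ≠ ⊤ :=
  ne_top_of_le_ne_top (ENNReal.mul_ne_top (ENNReal.mul_ne_top ENNReal.ofReal_ne_top
    ENNReal.ofReal_ne_top) hu.2.ne) (tsum_eLpNorm_one_term_le ht hs)

theorem memLp_one_transfer [Countable ι] [CompleteSpace V] (ht : 0 < t) {A : ℝ}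
    (hs : ∀ i, |s i| ≤ A) (hu : MemLp u 1 volume) : MemLp (P.transfer s u) 1 volume :=
  memLp_tsum le_rfl (aestronglyMeasurable_term hu.1) (tsum_eLpNorm_one_term_ne_top ht hs hu)

theorem eLpNorm_transfer_le [Countable ι] (ht : 0 < t) {A : ℝ} (hA : 0 ≤ A)
    (hs : ∀ i, |s i| ≤ A) (hu0 : ∀ x ∉ ball (0 : Euc n) 1, u x = 0)
    (hm : AEStronglyMeasurable u volume) {p : ℝ} (hp : 0 < p) :
    eLpNorm (P.transfer s u) (ENNReal.ofReal p) volume ≤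
      ENNReal.ofReal (A * t ^ (n / p)) * eLpNorm u (ENNReal.ofReal p) volume := by
  have hp0 : ENNReal.ofReal p ≠ 0 := by simpa using hp
  have key : ∫⁻ x, ‖P.transfer s u x‖ₑ ^ p ≤
      ENNReal.ofReal A ^ p * ENNReal.ofReal (t ^ n) * ∫⁻ x, ‖u x‖ₑ ^ p := by
    refine le_trans ?_ (tsum_lintegral_term_le (P := P) (u := u) ht hs hp.le)
    rw [← lintegral_tsum fun i => ((aestronglyMeasurable_term hm i).enorm.pow_const p)]
    refine lintegral_mono fun x => ?_
    -- The supports are disjoint, so at each point at most one summand survives and the power `p`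
    -- passes inside the sum.
    by_cases hx : x ∈ ⋃ i, ball (P.c i) (P.r i)
    · obtain ⟨i, hi⟩ := mem_iUnion.1 hx
      rw [transfer_of_mem hu0 hi]
      exact ENNReal.le_tsum (f := fun i => ‖s i • u ((P.r i)⁻¹ • (x - P.c i))‖ₑ ^ p) i
    · rw [transfer_of_notMem hu0 hx]
      simp [hp]
  rw [eLpNorm_eq_lintegral_rpow_enorm_toReal hp0 ENNReal.ofReal_ne_top,
    eLpNorm_eq_lintegral_rpow_enorm_toReal hp0 ENNReal.ofReal_ne_top, ENNReal.toReal_ofReal hp.le]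
  refine (ENNReal.rpow_le_rpow key (by positivity)).trans_eq ?_
  rw [ENNReal.mul_rpow_of_nonneg _ _ (by positivity), ENNReal.mul_rpow_of_nonneg _ _ (by positivity),
    ← ENNReal.rpow_mul, mul_one_div_cancel hp.ne', ENNReal.rpow_one, ENNReal.ofReal_mul hA]
  congr 2
  rw [ENNReal.ofReal_rpow_of_nonneg (by positivity) (by positivity), ← Real.rpow_natCast,
    ← Real.rpow_mul ht.le, mul_one_div]

/-- By the chain rule the amplitude `A * r` in a ball of radius `r` becomes `A` for the derivative;
hence the two different weights. -/
theorem isWeakDerivOn_transfer [Countable ι] (ht : 0 < t) {A : ℝ} (hA : 0 ≤ A)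
    (hr : ∀ i, P.r i ≤ 1) {u : Euc n → Euc n} {g : Euc n → (Euc n →L[ℝ] Euc n)}
    (h : IsWeakDerivOn univ u g) (hu : MemLp u 1 volume) (hg : MemLp g 1 volume) :
    IsWeakDerivOn univ (P.transfer (fun i => A * P.r i) u) (P.transfer (fun _ => A) g) := by
  refine IsWeakDerivOn.tsum (fun i => ?_)
    (tsum_eLpNorm_one_term_ne_top (A := A) ht (fun i => ?_) hu)
    (tsum_eLpNorm_one_term_ne_top (A := A) ht (fun i => (abs_of_nonneg hA).le) hg)
  · have := h.rescale (P.c i) (P.r_pos i) (A * P.r i)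
    rwa [mul_inv_cancel_right₀ (P.r_pos i).ne'] at this
  · rw [abs_of_nonneg (mul_nonneg hA (P.r_pos i).le)]
    exact mul_le_of_le_one_right hA (hr i)

end BallPacking

namespace BallPacking

/-! ### The series of iterates of the transfer operator -/

section Series

variable {n : ℕ} {t : ℝ} {ι : Type*} (P : BallPacking n t ι)
  {V : Type*} [NormedAddCommGroup V] [NormedSpace ℝ V]

/-- The iterates of the transfer operator on `w`. -/
noncomputable def iter (s : ι → ℝ) (w : Euc n → V) : ℕ → Euc n → V
  | 0 => w
  | k + 1 => P.transfer s (iter s w k)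

/-- The sum of all iterates of the transfer operator on `w`. -/
noncomputable def series (s : ι → ℝ) (w : Euc n → V) (x : Euc n) : V :=
  ∑' k, P.iter s w k x

variable {P} {s : ι → ℝ} {w : Euc n → V} {A : ℝ}

theorem iter_eq_zero (ht1 : t ≤ 1) (hw : ∀ x ∉ ball (0 : Euc n) 1, w x = 0) (k : ℕ) :
    ∀ x ∉ ball (0 : Euc n) 1, P.iter s w k x = 0 := by
  induction k with
  | zero => exact hw
  | succ k ih => exact fun x hx => transfer_of_notMem_ball ih fun h => hx (ball_subset_ball ht1 h)

theorem series_eq_zero (ht1 : t ≤ 1) (hw : ∀ x ∉ ball (0 : Euc n) 1, w x = 0) :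
    ∀ x ∉ ball (0 : Euc n) 1, P.series s w x = 0 := fun x hx => by
  simp only [series, iter_eq_zero ht1 hw _ x hx, tsum_zero]

variable [Countable ι] [CompleteSpace V]

theorem memLp_one_iter (ht : 0 < t) (hs : ∀ i, |s i| ≤ A) (hw1 : MemLp w 1 volume) (k : ℕ) :
    MemLp (P.iter s w k) 1 volume := by
  induction k with
  | zero => exact hw1
  | succ k ih => exact memLp_one_transfer ht hs ih

theorem eLpNorm_iter_le (ht : 0 < t) (ht1 : t ≤ 1) (hA : 0 ≤ A) (hs : ∀ i, |s i| ≤ A)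
    (hw : ∀ x ∉ ball (0 : Euc n) 1, w x = 0) (hw1 : MemLp w 1 volume) {p : ℝ} (hp : 0 < p)
    (k : ℕ) : eLpNorm (P.iter s w k) (ENNReal.ofReal p) volume ≤
      ENNReal.ofReal (A * t ^ (n / p)) ^ k * eLpNorm w (ENNReal.ofReal p) volume := by
  induction k with
  | zero => simp [iter]
  | succ k ih =>
    refine (eLpNorm_transfer_le ht hA hs (iter_eq_zero ht1 hw k)
      (memLp_one_iter ht hs hw1 k).1 hp).trans ?_
    rw [pow_succ', mul_assoc]
    gcongr

theorem tsum_eLpNorm_iter_ne_top (ht : 0 < t) (ht1 : t ≤ 1) (hA : 0 ≤ A) (hs : ∀ i, |s i| ≤ A)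
    (hw : ∀ x ∉ ball (0 : Euc n) 1, w x = 0) (hw1 : MemLp w 1 volume) {p : ℝ} (hp : 0 < p)
    (hwp : MemLp w (ENNReal.ofReal p) volume) (hAt : A * t ^ (n / p) < 1) :
    ∑' k, eLpNorm (P.iter s w k) (ENNReal.ofReal p) volume ≠ ⊤ := by
  refine ne_top_of_le_ne_top ?_
    (ENNReal.tsum_le_tsum (eLpNorm_iter_le (P := P) ht ht1 hA hs hw hw1 hp))
  rw [ENNReal.tsum_mul_right, ENNReal.tsum_geometric]
  refine ENNReal.mul_ne_top (ENNReal.inv_ne_top.2 ?_) hwp.2.ne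
  rw [← ENNReal.ofReal_one] at *
  rw [← ENNReal.ofReal_sub _ (by positivity)]
  simpa using hAt

theorem memLp_series (ht : 0 < t) (ht1 : t ≤ 1) (hA : 0 ≤ A) (hs : ∀ i, |s i| ≤ A)
    (hw : ∀ x ∉ ball (0 : Euc n) 1, w x = 0) (hw1 : MemLp w 1 volume) {p : ℝ} (hp : 1 ≤ p)
    (hwp : MemLp w (ENNReal.ofReal p) volume) (hAt : A * t ^ (n / p) < 1) :
    MemLp (P.series s w) (ENNReal.ofReal p) volume :=
  memLp_tsum (by simpa using ENNReal.ofReal_le_ofReal hp)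
    (fun k => (memLp_one_iter ht hs hw1 k).1)
    (tsum_eLpNorm_iter_ne_top ht ht1 hA hs hw hw1 (by positivity) hwp hAt)

theorem tsum_eLpNorm_one_iter_ne_top (ht : 0 < t) (ht1 : t ≤ 1) (hA : 0 ≤ A)
    (hs : ∀ i, |s i| ≤ A) (hw : ∀ x ∉ ball (0 : Euc n) 1, w x = 0) (hw1 : MemLp w 1 volume)
    (hAt : A * t ^ n < 1) : ∑' k, eLpNorm (P.iter s w k) 1 volume ≠ ⊤ := by
  have := tsum_eLpNorm_iter_ne_top (P := P) (p := 1) ht ht1 hA hs hw hw1 one_pos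
    (by simpa using hw1) (by simpa using hAt)
  simpa using this

/-- The functional equation of the series. -/
theorem ae_series_eq (ht : 0 < t) (ht1 : t ≤ 1) (hA : 0 ≤ A)
    (hs : ∀ i, |s i| ≤ A) (hw : ∀ x ∉ ball (0 : Euc n) 1, w x = 0) (hw1 : MemLp w 1 volume)
    (hAt : A * t ^ n < 1) :
    ∀ᵐ x, P.series s w x = w x + P.transfer s (P.series s w) x := by
  have hsum := summable_norm_of_tsum_eLpNorm_ne_top le_rfl
    (fun k => (memLp_one_iter (P := P) ht hs hw1 k).1)
    (tsum_eLpNorm_one_iter_ne_top ht ht1 hA hs hw hw1 hAt)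
  filter_upwards [hsum] with x hx
  -- Splitting off the term `k = 0` needs summability, which is only known a.e.; the identity is
  -- therefore an a.e. statement.
  rw [series, hx.of_norm.tsum_eq_zero_add]
  congr 1
  by_cases h : x ∈ ⋃ i, ball (P.c i) (P.r i)
  · obtain ⟨i, hi⟩ := mem_iUnion.1 h
    rw [transfer_of_mem (series_eq_zero ht1 hw) hi, series, ← tsum_const_smul'']
    congr 1
    ext1 k
    exact transfer_of_mem (iter_eq_zero ht1 hw k) hi
  · rw [transfer_of_notMem (series_eq_zero ht1 hw) h]
    convert! tsum_zero with k
    exact transfer_of_notMem (iter_eq_zero ht1 hw k) h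

theorem isWeakDerivOn_series {A : ℝ} (ht : 0 < t) (ht1 : t ≤ 1) (hA : 0 ≤ A)
    (hr : ∀ i, P.r i ≤ 1) {u : Euc n → Euc n} {g : Euc n → (Euc n →L[ℝ] Euc n)}
    (h : IsWeakDerivOn univ u g) (hu0 : ∀ x ∉ ball (0 : Euc n) 1, u x = 0)
    (hg0 : ∀ x ∉ ball (0 : Euc n) 1, g x = 0) (hu : MemLp u 1 volume) (hg : MemLp g 1 volume)
    (hAt : A * t ^ n < 1) :
    IsWeakDerivOn univ (P.series (fun i => A * P.r i) u) (P.series (fun _ => A) g) := by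
  have hs : ∀ i, |A * P.r i| ≤ A := fun i => by
    rw [abs_of_nonneg (mul_nonneg hA (P.r_pos i).le)]
    exact mul_le_of_le_one_right hA (hr i)
  have hs' : ∀ i : ι, |A| ≤ A := fun i => (abs_of_nonneg hA).le
  refine IsWeakDerivOn.tsum (fun k => ?_)
    (tsum_eLpNorm_one_iter_ne_top ht ht1 hA hs hu0 hu hAt)
    (tsum_eLpNorm_one_iter_ne_top ht ht1 hA hs' hg0 hg hAt)
  induction k with
  | zero => exact h
  | succ k ih =>
    exact isWeakDerivOn_transfer ht hA hr ih (memLp_one_iter ht hs hu k)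
      (memLp_one_iter ht hs' hg k)

end Series

/-! ### The self-similar map of a packing -/

section SelfSimilar

variable {n : ℕ} {t : ℝ} {ι : Type*}

/-- The difference of the truncations at `t` and at `1` is the seed of the series. It must vanish
off the unit ball for its copies to stay in the balls of the packing. -/
theorem _root_.radialStretch_sub_eq_zero {b : ℝ} (ht1 : t ≤ 1) :
    ∀ x ∉ ball (0 : Euc n) 1, radialStretch b t x - radialStretch b 1 x = 0 := fun x hx => by
  rw [mem_ball_zero_iff, not_lt] at hx
  rw [radialStretch_of_ge hx, radialStretch_of_ge (ht1.trans hx), sub_self]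

theorem _root_.radialStretchDeriv_sub_eq_zero {b : ℝ} (ht1 : t ≤ 1) :
    ∀ x ∉ ball (0 : Euc n) 1, radialStretchDeriv b t x - radialStretchDeriv b 1 x = 0 :=
  fun x hx => by
    rw [mem_ball_zero_iff, not_lt] at hx
    rw [radialStretchDeriv_of_ge hx, radialStretchDeriv_of_ge (ht1.trans hx), sub_self]

theorem _root_.memLp_of_bounded_of_ball {V : Type*} [NormedAddCommGroup V] {w : Euc n → V} {C : ℝ}
    (hm : AEStronglyMeasurable w volume) (hC : ∀ᵐ x, ‖w x‖ ≤ C)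
    (h0 : ∀ x ∉ ball (0 : Euc n) 1, w x = 0) (q : ℝ≥0∞) : MemLp w q volume := by
  have h1 : MemLp w q (volume.restrict (ball 0 1)) :=
    have : IsFiniteMeasure ((volume : Measure (Euc n)).restrict (ball 0 1)) :=
      ⟨by simpa using measure_ball_lt_top⟩
    MemLp.of_bound hm.restrict C (ae_restrict_of_ae hC)
  rw [← memLp_indicator_iff_restrict measurableSet_ball] at h1
  convert h1
  symm
  rw [indicator_eq_self]
  intro x hx
  by_contra h
  exact hx (h0 x h)

theorem _root_.ae_norm_radialStretchDeriv_le {b : ℝ} (hb : 1 ≤ b) (ht : 0 < t) :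
    ∃ C : ℝ, ∀ᵐ x : Euc n, ‖radialStretchDeriv b t x‖ ≤ C := by
  obtain ⟨C, hC⟩ := exists_lipschitzWith_radialStretch (n := n) hb ht
  exact ⟨C, (ae_hasFDerivAt_radialStretch ht).mono fun x hx => hx.le_of_lipschitz hC⟩

theorem _root_.isWeakDerivOn_radialStretch {b : ℝ} (hb : 1 ≤ b) (ht : 0 < t) :
    IsWeakDerivOn univ (radialStretch b t : Euc n → Euc n) (radialStretchDeriv b t) := by
  obtain ⟨C, hC⟩ := exists_lipschitzWith_radialStretch (n := n) hb ht
  exact isWeakDerivOn_of_lipschitzWith hC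
    (measurable_radialStretchDeriv b t).aestronglyMeasurable (ae_hasFDerivAt_radialStretch ht)

theorem _root_.isWeakDerivOn_radialStretch_sub {b : ℝ} (hb : 1 ≤ b) (ht : 0 < t) :
    IsWeakDerivOn univ (fun x : Euc n => radialStretch b t x - radialStretch b 1 x)
      (fun x => radialStretchDeriv b t x - radialStretchDeriv b 1 x) := by
  obtain ⟨C, hC⟩ := exists_lipschitzWith_radialStretch (n := n) hb ht
  obtain ⟨C', hC'⟩ := exists_lipschitzWith_radialStretch (n := n) hb one_pos
  refine isWeakDerivOn_of_lipschitzWith (hC.sub hC')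
    ((measurable_radialStretchDeriv b t).sub
      (measurable_radialStretchDeriv b 1)).aestronglyMeasurable ?_
  filter_upwards [ae_hasFDerivAt_radialStretch ht, ae_hasFDerivAt_radialStretch one_pos]
    with x hx hx' using hx.sub hx'

theorem _root_.memLp_radialStretch_sub {b : ℝ} (hb : 1 ≤ b) (ht : 0 < t) (ht1 : t ≤ 1)
    (q : ℝ≥0∞) :
    MemLp (fun x : Euc n => radialStretch b t x - radialStretch b 1 x) q volume := by
  obtain ⟨C, hC⟩ := exists_lipschitzWith_radialStretch (n := n) hb ht
  obtain ⟨C', hC'⟩ := exists_lipschitzWith_radialStretch (n := n) hb one_pos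
  have hc : Continuous fun x : Euc n => radialStretch b t x - radialStretch b 1 x :=
    hC.continuous.sub hC'.continuous
  obtain ⟨D, hD⟩ := (isCompact_closedBall (0 : Euc n) 1).exists_bound_of_continuousOn
    hc.continuousOn
  refine memLp_of_bounded_of_ball hc.aestronglyMeasurable (C := max D 0) (.of_forall fun x => ?_)
    (radialStretch_sub_eq_zero ht1) q
  by_cases hx : x ∈ ball (0 : Euc n) 1
  · exact (hD x (ball_subset_closedBall hx)).trans (le_max_left _ _)
  · rw [radialStretch_sub_eq_zero ht1 x hx, norm_zero]
    exact le_max_right _ _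

theorem _root_.memLp_radialStretchDeriv_sub {b : ℝ} (hb : 1 ≤ b) (ht : 0 < t) (ht1 : t ≤ 1)
    (q : ℝ≥0∞) :
    MemLp (fun x : Euc n => radialStretchDeriv b t x - radialStretchDeriv b 1 x) q volume := by
  obtain ⟨C, hC⟩ := ae_norm_radialStretchDeriv_le (n := n) hb ht
  obtain ⟨C', hC'⟩ := ae_norm_radialStretchDeriv_le (n := n) hb one_pos
  refine memLp_of_bounded_of_ball ((measurable_radialStretchDeriv b t).sub
    (measurable_radialStretchDeriv b 1)).aestronglyMeasurable (C := C + C') ?_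
    (radialStretchDeriv_sub_eq_zero ht1) q
  filter_upwards [hC, hC'] with x hx hx'
  exact (norm_sub_le _ _).trans (add_le_add hx hx')

variable (P : BallPacking n t ι)

/-- The self-similar map: a truncated radial stretching in which the dilation on the core ball is
replaced, in every ball of the packing, by a rescaled copy of the map itself. -/
noncomputable def selfSimilarMap (b : ℝ) (x : Euc n) : Euc n :=
  radialStretch b 1 x + P.series (fun i => t ^ (-b) * P.r i)
    (fun x => radialStretch b t x - radialStretch b 1 x) x

/-- The weak derivative of `selfSimilarMap`. -/
noncomputable def selfSimilarDeriv (b : ℝ) (x : Euc n) : Euc n →L[ℝ] Euc n :=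
  radialStretchDeriv b 1 x + P.series (fun _ => t ^ (-b))
    (fun x => radialStretchDeriv b t x - radialStretchDeriv b 1 x) x

variable {P} {b : ℝ} [Countable ι]

/-- Contraction of the transfer operator on `L^p`, for `c = n / p`: this is where `b * p < n`
enters. -/
theorem _root_.rpow_neg_mul_rpow_lt_one (ht : 0 < t) (ht1 : t < 1) {c : ℝ} (h : b < c) :
    t ^ (-b) * t ^ c < 1 := by
  rw [← Real.rpow_add ht]
  exact Real.rpow_lt_one ht.le ht1 (by linarith)

theorem abs_rpow_mul_radius_le (hn : n ≠ 0) (ht : 0 < t) (ht1 : t ≤ 1) (i : ι) :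
    |t ^ (-b) * P.r i| ≤ t ^ (-b) := by
  have hA : 0 ≤ t ^ (-b) := by positivity
  rw [abs_of_nonneg (mul_nonneg hA (P.r_pos i).le)]
  exact mul_le_of_le_one_right hA ((P.radius_le hn ht i).trans ht1)

theorem isWeakDerivOn_selfSimilarMap (ht : 0 < t) (ht1 : t < 1) (hb : 1 ≤ b) (hbn : b < n) :
    IsWeakDerivOn univ (P.selfSimilarMap b) (P.selfSimilarDeriv b) := by
  have hn : n ≠ 0 := by rintro rfl; norm_num at hbn; linarith
  refine (isWeakDerivOn_radialStretch hb one_pos).add (isWeakDerivOn_series ht ht1.le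
    (by positivity) (fun i => (P.radius_le hn ht i).trans ht1.le)
    (isWeakDerivOn_radialStretch_sub hb ht) (radialStretch_sub_eq_zero ht1.le)
    (radialStretchDeriv_sub_eq_zero ht1.le) (memLp_radialStretch_sub hb ht ht1.le 1)
    (memLp_radialStretchDeriv_sub hb ht ht1.le 1) ?_)
  rw [← Real.rpow_natCast]
  exact rpow_neg_mul_rpow_lt_one ht ht1 hbn

theorem memLp_selfSimilarMap (ht : 0 < t) (ht1 : t < 1) (hb : 1 ≤ b) {p : ℝ} (hp : 1 ≤ p)
    (hbp : b * p < n) {C : Set (Euc n)} (hC : IsCompact C) :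
    MemLp (P.selfSimilarMap b) (ENNReal.ofReal p) (volume.restrict C) := by
  have hn : n ≠ 0 := by rintro rfl; norm_num at hbp; nlinarith
  have hbn : b < n / p := by rwa [lt_div_iff₀ (by positivity)]
  obtain ⟨C', hC'⟩ := exists_lipschitzWith_radialStretch (n := n) hb one_pos
  refine MemLp.add ?_ ((memLp_series ht ht1.le (by positivity) (abs_rpow_mul_radius_le hn ht ht1.le)
    (radialStretch_sub_eq_zero ht1.le) (memLp_radialStretch_sub hb ht ht1.le _) hp
    (memLp_radialStretch_sub hb ht ht1.le _) (rpow_neg_mul_rpow_lt_one ht ht1 hbn)).restrict C)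
  have : IsFiniteMeasure ((volume : Measure (Euc n)).restrict C) :=
    ⟨by simpa using hC.measure_lt_top⟩
  obtain ⟨D, hD⟩ := hC.exists_bound_of_continuousOn hC'.continuous.continuousOn
  exact MemLp.of_bound hC'.continuous.aestronglyMeasurable D
    ((ae_restrict_iff' hC.measurableSet).2 (.of_forall hD))

theorem memLp_selfSimilarDeriv (ht : 0 < t) (ht1 : t < 1) (hb : 1 ≤ b) {p : ℝ} (hp : 1 ≤ p)
    (hbp : b * p < n) {C : Set (Euc n)} (hC : IsCompact C) :
    MemLp (P.selfSimilarDeriv b) (ENNReal.ofReal p) (volume.restrict C) := by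
  have hbn : b < n / p := by rwa [lt_div_iff₀ (by positivity)]
  obtain ⟨D, hD⟩ := ae_norm_radialStretchDeriv_le (n := n) hb one_pos
  refine MemLp.add ?_ ((memLp_series ht ht1.le (by positivity)
    (fun i => (abs_of_nonneg (by positivity)).le)
    (radialStretchDeriv_sub_eq_zero ht1.le) (memLp_radialStretchDeriv_sub hb ht ht1.le _) hp
    (memLp_radialStretchDeriv_sub hb ht ht1.le _)
    (rpow_neg_mul_rpow_lt_one ht ht1 hbn)).restrict C)
  have : IsFiniteMeasure ((volume : Measure (Euc n)).restrict C) :=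
    ⟨by simpa using hC.measure_lt_top⟩
  exact MemLp.of_bound (measurable_radialStretchDeriv b 1).aestronglyMeasurable D
    (ae_restrict_of_ae hD)

theorem ae_selfSimilarMap_eq (ht : 0 < t) (ht1 : t < 1) (hb : 1 ≤ b) (hbn : b < n) :
    ∀ᵐ x, P.selfSimilarMap b x = radialStretch b t x + P.transfer (fun i => t ^ (-b) * P.r i)
      (P.series (fun i => t ^ (-b) * P.r i)
        (fun x => radialStretch b t x - radialStretch b 1 x)) x := by
  have hn : n ≠ 0 := by rintro rfl; norm_num at hbn; linarith
  have h := ae_series_eq (P := P) ht ht1.le (by positivity)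
    (abs_rpow_mul_radius_le (P := P) (b := b) hn ht ht1.le) (radialStretch_sub_eq_zero (b := b) ht1.le)
    (memLp_radialStretch_sub hb ht ht1.le 1)
    (by rw [← Real.rpow_natCast]; exact rpow_neg_mul_rpow_lt_one ht ht1 hbn)
  filter_upwards [h] with x hx
  rw [selfSimilarMap, hx]
  abel

theorem ae_selfSimilarDeriv_eq (ht : 0 < t) (ht1 : t < 1) (hb : 1 ≤ b) (hbn : b < n) :
    ∀ᵐ x, P.selfSimilarDeriv b x = radialStretchDeriv b t x + P.transfer (fun _ => t ^ (-b))
      (P.series (fun _ => t ^ (-b))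
        (fun x => radialStretchDeriv b t x - radialStretchDeriv b 1 x)) x := by
  have h := ae_series_eq (P := P) (A := t ^ (-b)) ht ht1.le (by positivity)
    (fun i => (abs_of_nonneg (by positivity)).le) (radialStretchDeriv_sub_eq_zero (b := b) ht1.le)
    (memLp_radialStretchDeriv_sub hb ht ht1.le 1)
    (by rw [← Real.rpow_natCast]; exact rpow_neg_mul_rpow_lt_one ht ht1 hbn)
  filter_upwards [h] with x hx
  rw [selfSimilarDeriv, hx]
  abel

/-- Near the boundary of the unit ball the self-similar map is the radial stretching. -/
theorem ae_selfSimilarMap_of_le_norm (ht : 0 < t) (ht1 : t < 1) (hb : 1 ≤ b) (hbn : b < n) :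
    ∀ᵐ x, t ≤ ‖x‖ → P.selfSimilarMap b x = ‖x‖ ^ (-b) • x := by
  filter_upwards [ae_selfSimilarMap_eq (P := P) ht ht1 hb hbn] with x hx h
  rw [hx, radialStretch_of_ge h, transfer_of_notMem_ball
    (series_eq_zero ht1.le (radialStretch_sub_eq_zero ht1.le)) (by simpa using h), add_zero]

/-- The self-similarity of `selfSimilarMap`. -/
theorem ae_selfSimilarMap_of_mem (ht : 0 < t) (ht1 : t < 1) (hb : 1 ≤ b) (hbn : b < n) :
    ∀ᵐ x, ∀ i, x ∈ ball (P.c i) (P.r i) → P.selfSimilarMap b x = t ^ (-b) • P.c i +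
      (t ^ (-b) * P.r i) • P.selfSimilarMap b ((P.r i)⁻¹ • (x - P.c i)) := by
  filter_upwards [ae_selfSimilarMap_eq (P := P) ht ht1 hb hbn] with x hx i hi
  have hy := (mem_ball_iff_rescale (P.r_pos i)).2 hi
  rw [mem_ball_zero_iff] at hy
  have hxt := P.ball_subset i hi
  rw [mem_ball_zero_iff] at hxt
  -- With `y = (x - c) / r`, the dilation is `t^(-b) x = t^(-b) c + t^(-b) r y`. As `radialStretch b
  -- 1` is the identity on the unit ball, this `y` is the summand that completes the series to the
  -- map at `y`.
  rw [hx, radialStretch_of_le hxt.le, transfer_of_mem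
    (series_eq_zero ht1.le (radialStretch_sub_eq_zero ht1.le)) hi, selfSimilarMap,
    radialStretch_of_le hy.le, Real.one_rpow, one_smul, smul_add, ← add_assoc, smul_smul,
    mul_assoc, mul_inv_cancel₀ (P.r_pos i).ne', mul_one, ← smul_add, add_sub_cancel]

/-- The exceptional set `Z` is essentially contained in the core, and in each packing ball it is a
rescaled copy of part of itself. Thus `|Z| ≤ t^n |Z|` with `|Z|` finite and `t^n < 1`. Only outer
measure is used, so `Z` need not be measurable. -/
theorem ae_isReversingQuasiconformal (ht : 0 < t) (ht1 : t < 1) (hb : 1 < b) (hbn : b < n) {K : ℝ}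
    (hK : b - 1 ≤ K) (hK' : 1 ≤ K * (b - 1)) :
    ∀ᵐ x, IsReversingQuasiconformal K (P.selfSimilarDeriv b x) := by
  have hn : n ≠ 0 := by rintro rfl; norm_num at hbn; linarith
  set Z : Set (Euc n) := {x | ¬ IsReversingQuasiconformal K (P.selfSimilarDeriv b x)} with hZ
  have hg0 := series_eq_zero (P := P) (s := fun _ => t ^ (-b)) ht1.le
    (radialStretchDeriv_sub_eq_zero (n := n) (b := b) ht1.le)
  obtain ⟨N, hN, hNae⟩ : ∃ N : Set (Euc n), volume N = 0 ∧ ∀ x ∉ N, P.selfSimilarDeriv b x =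
      radialStretchDeriv b t x + P.transfer (fun _ => t ^ (-b)) (P.series (fun _ => t ^ (-b))
        (fun x => radialStretchDeriv b t x - radialStretchDeriv b 1 x)) x :=
    ⟨_, ae_iff.1 (ae_selfSimilarDeriv_eq (P := P) ht ht1 hb.le hbn), fun x hx => not_not.1 hx⟩
  have hZt : ∀ x ∈ Z, x ∉ N → x ∈ ball (0 : Euc n) t := by
    intro x hx hxN
    by_contra h
    refine hx ?_
    rw [hNae x hxN, transfer_of_notMem_ball hg0 h, add_zero]
    exact isReversingQuasiconformal_radialStretchDeriv hb hK hK' ht (by simpa using h)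
  have hsub : Z ⊆ (N ∪ (ball 0 t \ ⋃ i, ball (P.c i) (P.r i))) ∪
      ⋃ i, (fun x => (P.r i)⁻¹ • (x - P.c i)) ⁻¹' Z := by
    intro x hx
    by_cases hxN : x ∈ N
    · exact Or.inl (Or.inl hxN)
    have hxt := hZt x hx hxN
    by_cases h : x ∈ ⋃ i, ball (P.c i) (P.r i)
    · obtain ⟨i, hi⟩ := mem_iUnion.1 h
      refine Or.inr (mem_iUnion.2 ⟨i, ?_⟩)
      have hy := (mem_ball_iff_rescale (P.r_pos i)).2 hi
      rw [mem_ball_zero_iff] at hy hxt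
      intro hgood
      refine hx ?_
      rw [hNae x hxN, radialStretchDeriv_of_lt hxt, transfer_of_mem hg0 hi]
      rw [selfSimilarDeriv, radialStretchDeriv_of_lt hy, Real.one_rpow, one_smul] at hgood
      have hA : 0 ≤ t ^ (-b) := by positivity
      convert! hgood.smul hA using 1
      exact (smul_add _ _ _).symm
    · exact Or.inl (Or.inr ⟨hxt, h⟩)
  have hfin : volume Z ≠ ⊤ := by
    refine ne_top_of_le_ne_top (ENNReal.add_ne_top.2 ⟨hN.trans_ne ENNReal.zero_ne_top,
      (measure_ball_lt_top (μ := volume) (x := (0 : Euc n)) (r := t)).ne⟩)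
      ((measure_mono fun x hx => ?_).trans (measure_union_le N (ball 0 t)))
    exact or_iff_not_imp_left.2 (hZt x hx)
  have hle : volume Z ≤ ENNReal.ofReal (t ^ n) * volume Z := by
    calc volume Z ≤ volume (N ∪ (ball 0 t \ ⋃ i, ball (P.c i) (P.r i))) +
          ∑' i, volume ((fun x => (P.r i)⁻¹ • (x - P.c i)) ⁻¹' Z) :=
          (measure_mono hsub).trans ((measure_union_le _ _).trans
            (add_le_add le_rfl (measure_iUnion_le _)))
      _ = ∑' i, ENNReal.ofReal (P.r i ^ n) * volume Z := by
          rw [measure_union_null hN P.measure_diff, zero_add]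
          congr 1
          ext1 i
          exact measure_preimage_rescale _ (P.r_pos i) _
      _ ≤ _ := by
          rw [ENNReal.tsum_mul_right]
          gcongr
          exact P.tsum_radius_pow_le ht
  have hlt : ENNReal.ofReal (t ^ n) < 1 := by
    rw [ENNReal.ofReal_lt_one]
    exact pow_lt_one₀ ht.le ht1 hn
  rw [ae_iff]
  by_contra h0
  have : ENNReal.ofReal (t ^ n) * volume Z < 1 * volume Z :=
    (ENNReal.mul_lt_mul_iff_left h0 hfin).2 hlt
  rw [one_mul] at this
  exact absurd hle this.not_ge

end SelfSimilar

end BallPacking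

namespace BallPacking

/-! ### Growth of the averages along nested cells -/

section Growth

variable {n : ℕ} {t : ℝ} {ι : Type*} (P : BallPacking n t ι)

/-- The center of the `k`-th cell with address `z`. -/
noncomputable def cellCenter (β : ℝ) : ℕ → (ℕ → ι) → Euc n
  | 0, _ => 0
  | k + 1, z => P.c (z 0) + β • cellCenter β k fun j => z (j + 1)

/-- The point with address `z`. -/
noncomputable def limitPoint (β : ℝ) (z : ℕ → ι) : Euc n := ∑' k, β ^ k • P.c (z k)

variable {P} {β : ℝ}

theorem norm_term_limitPoint_le (hβ : 0 ≤ β) {z : ℕ → ι}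
    (hz : ∀ k, ‖P.c (z k)‖ ≤ 1 - β) (k : ℕ) : ‖β ^ k • P.c (z k)‖ ≤ β ^ k * (1 - β) := by
  rw [norm_smul, norm_pow, Real.norm_of_nonneg hβ]
  gcongr
  exact hz k

theorem hasSum_geometric_mul (hβ : 0 ≤ β) (hβ1 : β < 1) :
    HasSum (fun k : ℕ => β ^ k * (1 - β)) 1 := by
  have := (hasSum_geometric_of_lt_one hβ hβ1).mul_right (1 - β)
  rwa [inv_mul_cancel₀ (by linarith)] at this

theorem norm_limitPoint_le (hβ : 0 ≤ β) (hβ1 : β < 1) {z : ℕ → ι}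
    (hz : ∀ k, ‖P.c (z k)‖ ≤ 1 - β) : ‖P.limitPoint β z‖ ≤ 1 :=
  tsum_of_norm_bounded (hasSum_geometric_mul hβ hβ1) (norm_term_limitPoint_le hβ hz)

/-- Dropping the first digit of the address undoes the outermost similarity `y ↦ c + β y`; the
inductions on cells all peel off this similarity. Centers of norm at most `1 - β` make it preserve
the closed unit ball. -/
theorem limitPoint_eq (hβ : 0 ≤ β) (hβ1 : β < 1) {z : ℕ → ι}
    (hz : ∀ k, ‖P.c (z k)‖ ≤ 1 - β) :
    P.limitPoint β z = P.c (z 0) + β • P.limitPoint β fun j => z (j + 1) := by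
  have hs : Summable fun k => β ^ k • P.c (z k) :=
    Summable.of_norm_bounded (hasSum_geometric_mul hβ hβ1).summable
      (norm_term_limitPoint_le hβ hz)
  rw [limitPoint, hs.tsum_eq_zero_add, pow_zero, one_smul, limitPoint, ← tsum_const_smul'']
  simp_rw [smul_smul, pow_succ']

theorem norm_cellCenter_sub_limitPoint_le (hβ : 0 ≤ β) (hβ1 : β < 1) (k : ℕ) :
    ∀ {z : ℕ → ι}, (∀ k, ‖P.c (z k)‖ ≤ 1 - β) →
      ‖P.cellCenter β k z - P.limitPoint β z‖ ≤ β ^ k := by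
  induction k with
  | zero =>
    intro z hz
    simpa [cellCenter] using norm_limitPoint_le hβ hβ1 hz
  | succ k ih =>
    intro z hz
    rw [limitPoint_eq hβ hβ1 hz, cellCenter, add_sub_add_left_eq_sub, ← smul_sub, norm_smul,
      Real.norm_of_nonneg hβ, pow_succ']
    gcongr
    exact ih fun j => hz (j + 1)

theorem mem_ball_rescale_iff (hβ : 0 < β) {c C x : Euc n} {k : ℕ} :
    β⁻¹ • (x - c) ∈ ball C (β ^ k) ↔ x ∈ ball (c + β • C) (β ^ (k + 1)) := by
  have e : β⁻¹ • (x - c) - C = β⁻¹ • (x - (c + β • C)) := by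
    rw [← sub_sub, smul_sub β⁻¹ (x - c), smul_smul, inv_mul_cancel₀ hβ.ne', one_smul]
  rw [mem_ball_iff_norm, mem_ball_iff_norm, e, norm_smul, norm_inv, Real.norm_of_nonneg hβ.le,
    inv_mul_lt_iff₀ hβ, pow_succ']

theorem ball_cellCenter_subset (hβ : 0 < β) (ht1 : t ≤ 1) (k : ℕ) :
    ∀ {z : ℕ → ι}, (∀ k, P.r (z k) = β) → ball (P.cellCenter β k z) (β ^ k) ⊆ ball 0 1 := by
  induction k with
  | zero => intro z _; simp [cellCenter]
  | succ k ih =>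
    intro z hz x hx
    rw [cellCenter, ← mem_ball_rescale_iff hβ] at hx
    have hx' := ih (fun j => hz (j + 1)) hx
    rw [mem_ball_iff_rescale hβ, ← hz 0] at hx'
    exact ball_subset_ball ht1 (P.ball_subset _ hx')

variable [Countable ι] {b : ℝ}

/-- On the annulus the map is the odd stretching `S`, with `|S x| = |x|^(1-b) ≥ 1`. Pairing `x` with
`-x` gives `|v + s S x| + |v - s S x| ≥ 2|s|`, a bound independent of `v`. -/
theorem measure_annulus_le_lintegral (ht : 0 < t) (ht1 : t < 1) (hb : 1 ≤ b) (hbn : b < n)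
    (v : Euc n) (s : ℝ) :
    ENNReal.ofReal |s| * volume (ball (0 : Euc n) 1 \ ball 0 t) ≤
      ∫⁻ x in ball 0 1, ‖v + s • P.selfSimilarMap b x‖ₑ := by
  set R : Set (Euc n) := ball 0 1 \ ball 0 t with hR
  have hRm : MeasurableSet R := measurableSet_ball.diff measurableSet_ball
  set S : Euc n → Euc n := fun x => ‖x‖ ^ (-b) • x with hS
  have hSm : Measurable S := by
    have : Measurable fun x : Euc n => ‖x‖ ^ (-b) := by fun_prop
    exact this.smul measurable_id
  have hmem : ∀ x ∈ R, t ≤ ‖x‖ ∧ ‖x‖ < 1 := fun x hx => by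
    simpa [hR, and_comm] using hx
  have h1 : ∫⁻ x in R, ‖v + s • S x‖ₑ ≤ ∫⁻ x in ball 0 1, ‖v + s • P.selfSimilarMap b x‖ₑ := by
    refine le_trans (le_of_eq ?_) (lintegral_mono_set (hR ▸ sdiff_subset : R ⊆ ball 0 1))
    refine setLIntegral_congr_fun_ae hRm ?_
    filter_upwards [ae_selfSimilarMap_of_le_norm (P := P) ht ht1 hb hbn] with x hx hxR
    rw [hx (hmem x hxR).1]
  have h2 : ∫⁻ x in R, ‖v + s • S (-x)‖ₑ = ∫⁻ x in R, ‖v + s • S x‖ₑ := by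
    rw [← lintegral_indicator hRm, ← lintegral_indicator hRm]
    rw [← lintegral_neg_eq_self]
    congr 1
    ext1 x
    have : -x ∈ R ↔ x ∈ R := by simp [hR]
    by_cases hx : x ∈ R
    · rw [indicator_of_mem hx, indicator_of_mem (this.2 hx), neg_neg]
    · rw [indicator_of_notMem hx, indicator_of_notMem (mt this.1 hx)]
  have hm : Measurable fun x => ‖v + s • S x‖ₑ := (measurable_const.add (hSm.const_smul s)).enorm
  have h3 : 2 * (ENNReal.ofReal |s| * volume R) ≤ 2 * ∫⁻ x in R, ‖v + s • S x‖ₑ := by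
    rw [two_mul (∫⁻ x in R, ‖v + s • S x‖ₑ)]
    nth_rw 2 [← h2]
    rw [← lintegral_add_left hm, ← mul_assoc, ← setLIntegral_const]
    refine setLIntegral_mono' hRm fun x hx => ?_
    have hneg : S (-x) = -S x := by simp [hS]
    have hS1 : 1 ≤ ‖S x‖ := by
      obtain ⟨hx1, hx2⟩ := hmem x hx
      have hx0 : 0 < ‖x‖ := ht.trans_le hx1
      rw [hS]
      dsimp only
      rw [norm_smul, Real.norm_of_nonneg (by positivity), ← Real.rpow_add_one hx0.ne']
      exact Real.one_le_rpow_of_pos_of_le_one_of_nonpos hx0 hx2.le (by linarith)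
    have h2s : 2 * ENNReal.ofReal |s| = ENNReal.ofReal (2 * |s|) := by
      rw [ENNReal.ofReal_mul zero_le_two, ENNReal.ofReal_ofNat]
    rw [hneg, ← ofReal_norm, ← ofReal_norm, ← ENNReal.ofReal_add (norm_nonneg _) (norm_nonneg _),
      h2s]
    refine ENNReal.ofReal_le_ofReal ?_
    have h4 : (2 * s) • S x = (v + s • S x) - (v + s • -S x) := by module
    have h5 := norm_sub_le (v + s • S x) (v + s • -S x)
    rw [← h4, norm_smul, norm_mul, Real.norm_ofNat, Real.norm_eq_abs] at h5
    have := abs_nonneg s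
    nlinarith
  exact ((ENNReal.mul_le_mul_iff_right two_ne_zero ENNReal.ofNat_ne_top).1 h3).trans h1

/-- Passing to a subcell contributes `β^n` from the change of variables and `t^(-b) β` from the
amplitude. The translation created by self-similarity is absorbed in `v`, which is why `v` and `s`
are arbitrary in the induction. -/
theorem le_lintegral_cell (ht : 0 < t) (ht1 : t < 1) (hb : 1 ≤ b) (hbn : b < n) (hβ : 0 < β)
    (k : ℕ) : ∀ {z : ℕ → ι}, (∀ k, P.r (z k) = β) → ∀ (v : Euc n) (s : ℝ),
    ENNReal.ofReal |s| * ENNReal.ofReal (β ^ n * (t ^ (-b) * β)) ^ k *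
      volume (ball (0 : Euc n) 1 \ ball 0 t) ≤
      ∫⁻ x in ball (P.cellCenter β k z) (β ^ k), ‖v + s • P.selfSimilarMap b x‖ₑ := by
  induction k with
  | zero =>
    intro z _ v s
    simpa [cellCenter] using measure_annulus_le_lintegral (P := P) ht ht1 hb hbn v s
  | succ k ih =>
    intro z hz v s
    set z' : ℕ → ι := fun j => z (j + 1) with hz'
    set c := P.c (z 0) with hc
    set f := P.selfSimilarMap b with hf
    set A := t ^ (-b) with hA
    have hA0 : 0 ≤ A := by positivity
    set B := ball (P.cellCenter β k z') (β ^ k) with hB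
    have hBs : B ⊆ ball 0 1 := ball_cellCenter_subset hβ ht1.le k fun j => hz (j + 1)
    have hae := ae_selfSimilarMap_of_mem (P := P) ht ht1 hb hbn
    have e1 : ∫⁻ x in ball (P.cellCenter β (k + 1) z) (β ^ (k + 1)), ‖v + s • f x‖ₑ =
        ∫⁻ x, B.indicator (fun y => ‖(v + s • A • c) + (s * (A * β)) • f y‖ₑ)
          (β⁻¹ • (x - c)) := by
      rw [← lintegral_indicator measurableSet_ball]
      refine lintegral_congr_ae ?_
      filter_upwards [hae] with x hx
      by_cases h : x ∈ ball (P.cellCenter β (k + 1) z) (β ^ (k + 1))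
      · have h' : β⁻¹ • (x - c) ∈ B := (mem_ball_rescale_iff hβ).2 h
        have h'' : x ∈ ball c β := (mem_ball_iff_rescale hβ).1 (hBs h')
        have := hx (z 0) (by rwa [hz 0])
        rw [hz 0, ← hf, ← hA, ← hc] at this
        rw [indicator_of_mem h, indicator_of_mem h', this, smul_add, smul_smul s (A * β),
          ← add_assoc]
      · have h' : β⁻¹ • (x - c) ∉ B := fun h' => h ((mem_ball_rescale_iff hβ).1 h')
        rw [indicator_of_notMem h, indicator_of_notMem h']
    rw [e1, lintegral_rescale c hβ, lintegral_indicator measurableSet_ball]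
    refine le_trans (le_of_eq ?_) (mul_le_mul_right (ih (z := z') (fun j => hz (j + 1)) _ _) _)
    rw [abs_mul, abs_of_nonneg (mul_nonneg hA0 hβ.le), ENNReal.ofReal_mul (abs_nonneg _), pow_succ,
      ENNReal.ofReal_mul (p := β ^ n) (by positivity)]
    ring

/-- The limit point lies within `β^k` of the center of its `k`-th cell, so doubling the radius
captures the cell at the cost of `2^n` in volume. -/
theorem le_laverage (ht : 0 < t) (ht1 : t < 1) (hb : 1 ≤ b) (hbn : b < n)
    (hβ : 0 < β) (hβ1 : β < 1) {z : ℕ → ι} (hz : ∀ k, P.r (z k) = β)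
    (hzc : ∀ k, ‖P.c (z k)‖ ≤ 1 - β) (k : ℕ) :
    ENNReal.ofReal (t ^ (-b) * β) ^ k * (volume (ball (0 : Euc n) 1 \ ball 0 t) /
      (ENNReal.ofReal (2 ^ n) * volume (ball (0 : Euc n) 1))) ≤
      ⨍⁻ x in ball (P.limitPoint β z) (2 * β ^ k), ‖P.selfSimilarMap b x‖ₑ ∂volume := by
  have h1 := le_lintegral_cell (P := P) ht ht1 hb hbn hβ k hz 0 1
  have hsub : ball (P.cellCenter β k z) (β ^ k) ⊆ ball (P.limitPoint β z) (2 * β ^ k) := by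
    refine ball_subset_ball' ?_
    rw [dist_eq_norm]
    linarith [norm_cellCenter_sub_limitPoint_le hβ.le hβ1 k hzc]
  have h2 := h1.trans (lintegral_mono_set hsub)
  simp only [zero_add, one_smul, abs_one, ENNReal.ofReal_one, one_mul] at h2
  have hv : volume (ball (P.limitPoint β z) (2 * β ^ k)) =
      ENNReal.ofReal (β ^ n) ^ k * (ENNReal.ofReal (2 ^ n) * volume (ball (0 : Euc n) 1)) := by
    rw [Measure.addHaar_ball_of_pos _ _ (by positivity), finrank_euclideanSpace_fin, mul_pow,
      ENNReal.ofReal_mul (by positivity), ← pow_mul, mul_comm k n, pow_mul,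
      ENNReal.ofReal_pow (p := β ^ n) (by positivity)]
    ring
  have hβn : ENNReal.ofReal (β ^ n) ^ k ≠ 0 := by
    refine pow_ne_zero _ ?_
    rw [Ne, ENNReal.ofReal_eq_zero, not_le]
    positivity
  have hD : ENNReal.ofReal (2 ^ n) * volume (ball (0 : Euc n) 1) ≠ 0 :=
    mul_ne_zero (by simp) (measure_ball_pos _ _ one_pos).ne'
  have hD' : ENNReal.ofReal (2 ^ n) * volume (ball (0 : Euc n) 1) ≠ ⊤ :=
    ENNReal.mul_ne_top ENNReal.ofReal_ne_top measure_ball_lt_top.ne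
  rw [setLAverage_eq, hv, ENNReal.le_div_iff_mul_le
    (Or.inl (mul_ne_zero hβn hD))
    (Or.inl (ENNReal.mul_ne_top (ENNReal.pow_ne_top ENNReal.ofReal_ne_top) hD'))]
  refine le_trans (le_of_eq ?_) h2
  rw [ENNReal.ofReal_mul (p := β ^ n) (by positivity), mul_pow]
  calc _ = ENNReal.ofReal (β ^ n) ^ k * ENNReal.ofReal (t ^ (-b) * β) ^ k *
        ((volume (ball (0 : Euc n) 1 \ ball 0 t) /
          (ENNReal.ofReal (2 ^ n) * volume (ball (0 : Euc n) 1))) *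
          (ENNReal.ofReal (2 ^ n) * volume (ball (0 : Euc n) 1))) := by ring
    _ = _ := by rw [ENNReal.div_mul_cancel hD hD']

theorem tendsto_laverage (hn : n ≠ 0) (ht : 0 < t) (ht1 : t < 1) (hb : 1 ≤ b) (hbn : b < n)
    (hβ : 0 < β) (hβ1 : β < 1) (hκ : 1 < t ^ (-b) * β) {z : ℕ → ι} (hz : ∀ k, P.r (z k) = β)
    (hzc : ∀ k, ‖P.c (z k)‖ ≤ 1 - β) :
    Tendsto (fun k : ℕ => ⨍⁻ x in ball (P.limitPoint β z) (2 * β ^ k),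
      ‖P.selfSimilarMap b x‖ₑ ∂volume)
      atTop (𝓝 ⊤) := by
  refine tendsto_of_tendsto_of_tendsto_of_le_of_le ?_ tendsto_const_nhds
    (le_laverage (P := P) ht ht1 hb hbn hβ hβ1 hz hzc) fun _ => le_top
  have hann : volume (ball (0 : Euc n) 1 \ ball 0 t) ≠ 0 := by
    rw [measure_sdiff (ball_subset_ball ht1.le) measurableSet_ball.nullMeasurableSet
      measure_ball_lt_top.ne]
    refine (tsub_pos_iff_lt.2 ?_).ne'
    rw [Measure.addHaar_ball_of_pos _ _ ht]
    have : ENNReal.ofReal (t ^ Module.finrank ℝ (Euc n)) < 1 := by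
      rw [ENNReal.ofReal_lt_one, finrank_euclideanSpace_fin]
      exact pow_lt_one₀ ht.le ht1 hn
    calc _ < 1 * volume (ball (0 : Euc n) 1) := (ENNReal.mul_lt_mul_iff_left
          (measure_ball_pos _ _ one_pos).ne' measure_ball_lt_top.ne).2 this
      _ = _ := one_mul _
  have hd : volume (ball (0 : Euc n) 1 \ ball 0 t) /
      (ENNReal.ofReal (2 ^ n) * volume (ball (0 : Euc n) 1)) ≠ 0 :=
    ENNReal.div_ne_zero.2 ⟨hann, ENNReal.mul_ne_top ENNReal.ofReal_ne_top measure_ball_lt_top.ne⟩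
  have hpow : Tendsto (fun k : ℕ => ENNReal.ofReal (t ^ (-b) * β) ^ k) atTop (𝓝 ⊤) := by
    simp_rw [← ENNReal.ofReal_pow (zero_le_one.trans hκ.le)]
    exact ENNReal.tendsto_ofReal_atTop.comp (tendsto_pow_atTop_atTop_of_one_lt hκ)
  have := ENNReal.Tendsto.mul_const hpow (b := volume (ball (0 : Euc n) 1 \ ball 0 t) /
      (ENNReal.ofReal (2 ^ n) * volume (ball (0 : Euc n) 1))) (Or.inl ENNReal.top_ne_zero)
  rwa [ENNReal.top_mul hd] at this

theorem _root_.laverage_rescale (x₀ : Euc n) {ρ : ℝ} (hρ : 0 < ρ) (φ : Euc n → ℝ≥0∞) (x : Euc n)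
    (r : ℝ) : ⨍⁻ y in ball (x₀ + ρ • x) (ρ * r), φ (ρ⁻¹ • (y - x₀)) ∂volume =
      ⨍⁻ y in ball x r, φ y ∂volume := by
  have hmem : ∀ y, ρ⁻¹ • (y - x₀) ∈ ball x r ↔ y ∈ ball (x₀ + ρ • x) (ρ * r) := fun y => by
    have e : ρ⁻¹ • (y - x₀) - x = ρ⁻¹ • (y - (x₀ + ρ • x)) := by
      rw [← sub_sub, smul_sub ρ⁻¹ (y - x₀), smul_smul, inv_mul_cancel₀ hρ.ne', one_smul]
    rw [mem_ball_iff_norm, mem_ball_iff_norm, e, norm_smul, norm_inv, Real.norm_of_nonneg hρ.le,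
      inv_mul_lt_iff₀ hρ]
  have h1 : ∫⁻ y in ball (x₀ + ρ • x) (ρ * r), φ (ρ⁻¹ • (y - x₀)) =
      ENNReal.ofReal (ρ ^ n) * ∫⁻ y in ball x r, φ y := by
    rw [← lintegral_indicator measurableSet_ball, ← lintegral_indicator measurableSet_ball,
      ← lintegral_rescale x₀ hρ]
    congr 1
    ext1 y
    by_cases h : y ∈ ball (x₀ + ρ • x) (ρ * r)
    · rw [indicator_of_mem h, indicator_of_mem ((hmem y).2 h)]
    · rw [indicator_of_notMem h, indicator_of_notMem (mt (hmem y).1 h)]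
  have h2 : volume (ball (x₀ + ρ • x) (ρ * r)) = ENNReal.ofReal (ρ ^ n) * volume (ball x r) := by
    rw [← measure_preimage_rescale x₀ hρ]
    congr 1
    ext y
    exact (hmem y).symm
  rw [setLAverage_eq, setLAverage_eq, h1, h2, ENNReal.mul_div_mul_left _ _ _ ENNReal.ofReal_ne_top]
  rw [Ne, ENNReal.ofReal_eq_zero, not_le]
  positivity

theorem mem_singularSet (hn : n ≠ 0) (ht : 0 < t) (ht1 : t < 1) (hb : 1 ≤ b) (hbn : b < n)
    (hβ : 0 < β) (hβ1 : β < 1) (hκ : 1 < t ^ (-b) * β) {z : ℕ → ι} (hz : ∀ k, P.r (z k) = β)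
    (hzc : ∀ k, ‖P.c (z k)‖ ≤ 1 - β) {Ω : Set (Euc n)} {x₀ : Euc n} {ρ : ℝ} (hρ : 0 < ρ)
    (hΩ : closedBall x₀ ρ ⊆ Ω) :
    x₀ + ρ • P.limitPoint β z ∈
      singularSet Ω fun x => P.selfSimilarMap b (ρ⁻¹ • (x - x₀)) := by
  refine ⟨hΩ ?_, ?_⟩
  · rw [mem_closedBall_iff_norm, add_sub_cancel_left, norm_smul, Real.norm_of_nonneg hρ.le]
    exact mul_le_of_le_one_right hρ.le (norm_limitPoint_le hβ.le hβ1 hzc)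
  have h := tendsto_laverage (P := P) hn ht ht1 hb hbn hβ hβ1 hκ hz hzc
  simp_rw [← laverage_rescale x₀ hρ (fun x => ‖P.selfSimilarMap b x‖ₑ)] at h
  have hr : Tendsto (fun k : ℕ => ρ * (2 * β ^ k)) atTop (𝓝[>] 0) := by
    refine tendsto_nhdsWithin_iff.2 ⟨?_, .of_forall fun k => ?_⟩
    · simpa using ((tendsto_pow_atTop_nhds_zero_of_lt_one hβ.le hβ1).const_mul 2).const_mul ρ
    · exact mem_Ioi.2 (by positivity)
  -- The upper limit as `r → 0⁺` dominates the limit along the radii `ρ * (2 * β^k)`.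
  refine top_le_iff.1 (le_trans (le_of_eq ?_) (limsup_le_limsup_of_le hr))
  exact h.limsup_eq.symm

end Growth

end BallPacking

/-! ### Packings containing a grid of balls -/

section Grid

variable {n M : ℕ}

/-- The points of a cubic grid with mesh `3 * β`. -/
noncomputable def gridPoint (β : ℝ) (j : Fin n → Fin M) : Euc n :=
  WithLp.toLp 2 fun i => 3 * β * (j i : ℝ)

theorem norm_gridPoint_le {β : ℝ} (hβ : 0 ≤ β) (j : Fin n → Fin M) :
    ‖gridPoint β j‖ ≤ 3 * β * n * M := by
  rcases Nat.eq_zero_or_pos n with rfl | hn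
  · simp [Subsingleton.elim (gridPoint β j) 0]
  have hn1 : (1 : ℝ) ≤ n := by exact_mod_cast hn
  refine le_of_sq_le_sq ?_ (by positivity)
  rw [EuclideanSpace.norm_sq_eq]
  calc ∑ i, ‖(gridPoint β j) i‖ ^ 2 ≤ ∑ _i : Fin n, (3 * β * M) ^ 2 := by
        refine Finset.sum_le_sum fun i _ => ?_
        have : ((j i : ℕ) : ℝ) ≤ M := by exact_mod_cast (j i).2.le
        simp only [gridPoint]
        rw [Real.norm_of_nonneg (by positivity)]
        gcongr
    _ = n * (3 * β * M) ^ 2 := by simp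
    _ ≤ n ^ 2 * (3 * β * M) ^ 2 := by
        gcongr
        nlinarith
    _ = _ := by ring

theorem le_dist_gridPoint {β : ℝ} (hβ : 0 ≤ β) {j j' : Fin n → Fin M} (h : j ≠ j') :
    3 * β ≤ dist (gridPoint β j) (gridPoint β j') := by
  obtain ⟨i, hi⟩ := Function.ne_iff.1 h
  rw [dist_eq_norm]
  refine le_trans ?_ (PiLp.norm_apply_le _ i)
  have h1 : (1 : ℝ) ≤ |((j i : ℕ) : ℝ) - ((j' i : ℕ) : ℝ)| := by
    have : (1 : ℤ) ≤ |((j i : ℕ) : ℤ) - ((j' i : ℕ) : ℤ)| := by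
      refine Int.one_le_abs (sub_ne_zero.2 ?_)
      exact_mod_cast Fin.val_ne_of_ne hi
    exact_mod_cast this
  simp only [gridPoint, PiLp.sub_apply, ← mul_sub, norm_mul, Real.norm_eq_abs]
  rw [abs_of_nonneg hβ, abs_of_nonneg (by norm_num : (0 : ℝ) ≤ 3)]
  nlinarith

/-- The open set left after removing the closed grid balls is filled a.e. by disjoint closed balls
(Besicovitch covering). Passing to open balls only loses countably many spheres, which are null. -/
theorem exists_ballPacking_grid {β t : ℝ} (hβ : 0 < β)
    (hβt : 3 * β * n * M + 2 * β ≤ t) :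
    ∃ T : Set (Euc n), T.Countable ∧ ∃ P : BallPacking n t ((Fin n → Fin M) ⊕ T),
      ∀ j, P.c (Sum.inl j) = gridPoint β j ∧ P.r (Sum.inl j) = β := by
  set U : Set (Euc n) := ⋃ j : Fin n → Fin M, closedBall (gridPoint β j) β with hU
  have hUc : IsClosed U := isClosed_iUnion_of_finite fun j => isClosed_closedBall
  set G : Set (Euc n) := ball 0 t \ U with hG
  have hGo : IsOpen G := isOpen_ball.sdiff hUc
  obtain ⟨T, r, hTc, hTG, hr, hTm, hTd⟩ := Besicovitch.exists_disjoint_closedBall_covering_ae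
    (volume : Measure (Euc n)) (fun x => {r | closedBall x r ⊆ G}) G
    (fun x hx δ hδ => by
      obtain ⟨ε, hε, h⟩ := nhds_basis_closedBall.mem_iff.1 (hGo.mem_nhds hx)
      refine ⟨min ε (δ / 2), ?_, lt_min hε (half_pos hδ), ?_⟩
      · exact (closedBall_subset_closedBall (min_le_left _ _)).trans h
      · exact (min_le_right _ _).trans_lt (half_lt_self hδ)) (fun _ => 1) fun _ _ => one_pos
  let c : (Fin n → Fin M) ⊕ T → Euc n := Sum.elim (gridPoint β) Subtype.val
  let ρ : (Fin n → Fin M) ⊕ T → ℝ := Sum.elim (fun _ => β) fun x => r x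
  have hsubG : ∀ x : T, ball (x : Euc n) (r x) ⊆ G := fun x =>
    ball_subset_closedBall.trans (hr x x.2).1
  have hdisjU : ∀ (j : Fin n → Fin M) (x : T),
      Disjoint (ball (gridPoint β j) β) (ball (x : Euc n) (r x)) := fun j x => by
    rw [Set.disjoint_left]
    exact fun y hy hy' => (hsubG x hy').2 (mem_iUnion.2 ⟨j, ball_subset_closedBall hy⟩)
  have hρpos : ∀ i, 0 < ρ i := by
    rintro (j | x)
    · exact hβ
    · exact (hr x x.2).2.1
  refine ⟨T, hTc, ⟨c, ρ, hρpos, ?_, ?_, ?_⟩, fun j => ⟨rfl, rfl⟩⟩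
  · rintro (j | x)
    · refine ball_subset_ball' ?_
      have := norm_gridPoint_le hβ.le j
      simp only [c, ρ, Sum.elim_inl, dist_zero_right]
      linarith
    · exact (hsubG x).trans sdiff_subset
  · rintro (j | x) (j' | x') hne
    · refine ball_disjoint_ball ?_
      have := le_dist_gridPoint hβ.le fun h : j = j' => hne (by rw [h])
      simp only [c, ρ, Sum.elim_inl]
      linarith
    · exact hdisjU j x'
    · exact (hdisjU j' x).symm
    · exact (hTd x.2 x'.2 fun h => hne (by rw [Subtype.ext h])).mono ball_subset_closedBall
        ball_subset_closedBall
  · have : Countable T := hTc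
    have hsph : volume (⋃ i, sphere (c i) (ρ i)) = 0 :=
      measure_iUnion_null fun i => Measure.addHaar_sphere_of_ne_zero _ _ (hρpos i).ne'
    refine measure_mono_null ?_ (measure_union_null hTm hsph)
    rintro x ⟨hx, hx'⟩
    simp only [mem_iUnion, not_exists] at hx'
    have key : ∀ i, x ∈ closedBall (c i) (ρ i) → x ∈ ⋃ i, sphere (c i) (ρ i) := fun i hi => by
      refine mem_iUnion.2 ⟨i, ?_⟩
      rw [← closedBall_sdiff_ball]
      exact ⟨hi, hx' i⟩
    by_cases hxU : x ∈ U
    · obtain ⟨j, hj⟩ := mem_iUnion.1 hxU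
      exact Or.inr (key (Sum.inl j) hj)
    by_cases hxT : x ∈ ⋃ y ∈ T, closedBall y (r y)
    · simp only [mem_iUnion] at hxT
      obtain ⟨y, hy, hxy⟩ := hxT
      exact Or.inr (key (Sum.inr ⟨y, hy⟩) hxy)
    · exact Or.inl ⟨⟨hx, hxU⟩, hxT⟩

end Grid

/-! ### Hausdorff dimension of the limit set -/

section Dimension

/-- For `r > 0` the inequality forces `g` to factor through `f`, by an `r`-Hölder map on `range f`.
-/
theorem dimH_range_le_of_edist_le {α X Y : Type*} [EMetricSpace X] [EMetricSpace Y]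
    {f : α → X} {g : α → Y} {C r : NNReal} (hr : 0 < r)
    (h : ∀ a b, edist (g a) (g b) ≤ C * edist (f a) (f b) ^ (r : ℝ)) :
    dimH (range g) ≤ dimH (range f) / r := by
  rcases isEmpty_or_nonempty α with hα | hα
  · simp [range_eq_empty]
  let φ : X → α := Function.invFun f
  have hφ : ∀ a, f (φ (f a)) = f a := fun a => Function.invFun_eq ⟨a, rfl⟩
  have h1 : HolderOnWith C r (g ∘ φ) (range f) := by
    rintro _ ⟨a, rfl⟩ _ ⟨b, rfl⟩
    have := h (φ (f a)) (φ (f b))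
    rwa [hφ, hφ] at this
  have h2 : range g ⊆ (g ∘ φ) '' range f := by
    rintro _ ⟨a, rfl⟩
    refine ⟨f a, mem_range_self a, ?_⟩
    have := h (φ (f a)) a
    rw [hφ, edist_self, ENNReal.zero_rpow_of_pos (by exact_mod_cast hr), mul_zero] at this
    exact edist_le_zero.1 this
  exact (dimH_mono h2).trans (h1.dimH_image_le hr)

/-- The point of the unit cube whose coordinates have prescribed digits in base `M`. -/
noncomputable def cubePoint {n M : ℕ} (z : ℕ → Fin n → Fin M) : Fin n → ℝ :=
  fun i => Real.ofDigits fun k => z k i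

/-- Every point of `[0,1)^n` has base-`M` digits, so the range contains a ball of the sup norm. -/
theorem le_dimH_range_cubePoint {n M : ℕ} (hM : 1 < M) :
    (n : ℝ≥0∞) ≤ dimH (range (cubePoint : (ℕ → Fin n → Fin M) → Fin n → ℝ)) := by
  have : NeZero M := ⟨by omega⟩
  rw [← Real.dimH_ball_pi_fin (fun _ : Fin n => (1 / 2 : ℝ)) (half_pos one_pos)]
  refine dimH_mono fun y hy => ?_
  have hy' : ∀ i, y i ∈ Ico (0 : ℝ) 1 := fun i => by
    have := (mem_ball.1 hy)
    have h1 := (dist_le_pi_dist y (fun _ : Fin n => (1 / 2 : ℝ)) i).trans_lt this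
    rw [Real.dist_eq, abs_lt] at h1
    constructor <;> linarith [h1.1, h1.2]
  exact ⟨fun k i => Real.digits (y i) M k, funext fun i => Real.ofDigits_digits hM (hy' i)⟩

theorem dist_cubePoint_le {n M : ℕ} {z z' : ℕ → Fin n → Fin M} {k : ℕ}
    (h : ∀ j < k, z j = z' j) : dist (cubePoint z) (cubePoint z') ≤ ((M : ℝ) ^ k)⁻¹ := by
  refine (dist_pi_le_iff (by positivity)).2 fun i => ?_
  exact Real.abs_ofDigits_sub_ofDigits_le fun j hj => by rw [h j hj]

namespace BallPacking

variable {n : ℕ} {t β : ℝ} {ι : Type*} {P : BallPacking n t ι}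

/-- At the first differing digit the centers are `3β` apart, while the remaining tails have norm at
most `β` each: `3β - 2β = β`. The common digits scale this by `β^k`. -/
theorem le_dist_limitPoint (hβ : 0 ≤ β) (hβ1 : β < 1) (k : ℕ) : ∀ {z z' : ℕ → ι},
    (∀ k, ‖P.c (z k)‖ ≤ 1 - β) → (∀ k, ‖P.c (z' k)‖ ≤ 1 - β) → (∀ j < k, z j = z' j) →
    3 * β ≤ dist (P.c (z k)) (P.c (z' k)) →
    β ^ (k + 1) ≤ dist (P.limitPoint β z) (P.limitPoint β z') := by
  induction k with
  | zero =>
    intro z z' hz hz' _ h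
    rw [limitPoint_eq hβ hβ1 hz, limitPoint_eq hβ hβ1 hz']
    have h1 : ∀ {w : ℕ → ι}, (∀ k, ‖P.c (w k)‖ ≤ 1 - β) →
        ‖β • P.limitPoint β fun j => w (j + 1)‖ ≤ β := fun hw => by
      rw [norm_smul, Real.norm_of_nonneg hβ]
      exact mul_le_of_le_one_right hβ (norm_limitPoint_le hβ hβ1 fun j => hw (j + 1))
    have h2 := h1 hz
    have h3 := h1 hz'
    set p := β • P.limitPoint β fun j => z (j + 1)
    set p' := β • P.limitPoint β fun j => z' (j + 1)
    rw [dist_eq_norm] at h ⊢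
    have h4 : P.c (z 0) - P.c (z' 0) = (P.c (z 0) + p - (P.c (z' 0) + p')) - (p - p') := by abel
    have h5 := norm_sub_le (P.c (z 0) + p - (P.c (z' 0) + p')) (p - p')
    rw [← h4] at h5
    have h6 := norm_sub_le p p'
    simp only [zero_add, pow_one]
    linarith
  | succ k ih =>
    intro z z' hz hz' hj h
    rw [limitPoint_eq hβ hβ1 hz, limitPoint_eq hβ hβ1 hz', hj 0 (Nat.succ_pos k), dist_add_left,
      dist_smul₀, Real.norm_of_nonneg hβ, pow_succ']
    gcongr
    exact ih (fun j => hz (j + 1)) (fun j => hz' (j + 1))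
      (fun j hjk => hj (j + 1) (Nat.succ_lt_succ hjk)) h

/-- If two addresses first differ at index `k`, the cube points are within `M^(-k) ≤ β^(k s)` and
the limit points at least `ρ β^(k+1)` apart. So limit points determine cube points in an `s`-Hölder
way, and a set of dimension `n` forces dimension at least `n s`. -/
theorem le_dimH_range_limitPoint {M : ℕ} (hM : 1 < M) (hβ : 0 < β) (hβ1 : β < 1)
    {e : (Fin n → Fin M) → ι} (hc : ∀ j, ‖P.c (e j)‖ ≤ 1 - β)
    (hsep : ∀ j j', j ≠ j' → 3 * β ≤ dist (P.c (e j)) (P.c (e j'))) {s : ℝ} (hs : 0 < s)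
    (hMs : (M : ℝ)⁻¹ ≤ β ^ s) (x₀ : Euc n) {ρ : ℝ} (hρ : 0 < ρ) :
    ENNReal.ofReal (n * s) ≤
      dimH (range fun z : ℕ → Fin n → Fin M => x₀ + ρ • P.limitPoint β fun k => e (z k)) := by
  set X : (ℕ → Fin n → Fin M) → Euc n := fun z => x₀ + ρ • P.limitPoint β fun k => e (z k)
  have hdist : ∀ z z', z ≠ z' →
      dist (cubePoint z) (cubePoint z') ≤ (ρ * β) ^ (-s) * dist (X z) (X z') ^ s := by
    intro z z' hne
    have hex : ∃ k, z k ≠ z' k := Function.ne_iff.1 hne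
    classical
    set k := Nat.find hex with hk
    have hk1 : z k ≠ z' k := Nat.find_spec hex
    have hk2 : ∀ j < k, z j = z' j := fun j hj => not_not.1 (Nat.find_min hex hj)
    have h1 := le_dist_limitPoint (P := P) hβ.le hβ1 k (z := fun k => e (z k))
      (z' := fun k => e (z' k)) (fun k => hc _) (fun k => hc _) (fun j hj => by rw [hk2 j hj])
      (hsep _ _ hk1)
    have h2 : ρ * β ^ (k + 1) ≤ dist (X z) (X z') := by
      simp only [X]
      rw [dist_add_left, dist_smul₀, Real.norm_of_nonneg hρ.le]
      gcongr
    have h3 : ((M : ℝ) ^ k)⁻¹ ≤ (β ^ s) ^ k := by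
      rw [← inv_pow]
      gcongr
    have h4 : (β ^ s) ^ k = (ρ * β) ^ (-s) * (ρ * β ^ (k + 1)) ^ s := by
      rw [pow_succ', ← mul_assoc, Real.mul_rpow (x := ρ * β) (by positivity) (by positivity),
        ← mul_assoc, ← Real.rpow_add (by positivity), neg_add_cancel, Real.rpow_zero, one_mul,
        ← Real.rpow_natCast, ← Real.rpow_natCast, ← Real.rpow_mul hβ.le, ← Real.rpow_mul hβ.le,
        mul_comm]
    calc _ ≤ ((M : ℝ) ^ k)⁻¹ := dist_cubePoint_le hk2
      _ ≤ (ρ * β) ^ (-s) * (ρ * β ^ (k + 1)) ^ s := h3.trans h4.le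
      _ ≤ _ := by gcongr
  have hC : (0 : ℝ) ≤ (ρ * β) ^ (-s) := by positivity
  have hold := dimH_range_le_of_edist_le (f := X) (g := cubePoint)
    (C := ((ρ * β) ^ (-s)).toNNReal) (r := s.toNNReal) (Real.toNNReal_pos.2 hs) (fun z z' => by
      rcases eq_or_ne z z' with rfl | hne
      · simp
      · rw [edist_dist, edist_dist, Real.coe_toNNReal _ hs.le,
          ENNReal.ofReal_rpow_of_nonneg dist_nonneg hs.le, ← ENNReal.ofReal,
          ← ENNReal.ofReal_mul hC]
        exact ENNReal.ofReal_le_ofReal (hdist z z' hne))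
  have h := (le_dimH_range_cubePoint (n := n) hM).trans hold
  rw [← ENNReal.ofReal, ENNReal.le_div_iff_mul_le (Or.inl (by simpa using hs))
    (Or.inl ENNReal.ofReal_ne_top)] at h
  rwa [ENNReal.ofReal_mul (Nat.cast_nonneg n), ENNReal.ofReal_natCast]

end BallPacking

end Dimension

/-! ### Singular sets of weakly quasiregular maps -/

/-- With `N = 8nM` and `t = N^(-1/(b-1))` one has `t^(1-b) = N`, so the growth factor is exactly
`2`, and `β ≥ N^(-b/(b-1))`. The last condition reduces to `N^e ≤ M` with `e = s b / (b - 1) < 1`,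
true for large `M`. -/
theorem exists_grid_parameters {n : ℕ} (hn : n ≠ 0) {b s : ℝ} (hb : 1 < b) (hs : 0 < s)
    (hsb : s < (b - 1) / b) : ∃ M : ℕ, 1 < M ∧ ∃ t : ℝ, 0 < t ∧ t < 1 ∧
      1 < t ^ (-b) * (t / (4 * n * M)) ∧ (M : ℝ)⁻¹ ≤ (t / (4 * n * M)) ^ s := by
  have ha : 0 < b - 1 := by linarith
  have hn1 : (1 : ℝ) ≤ n := by exact_mod_cast Nat.one_le_iff_ne_zero.2 hn
  set e : ℝ := s * (b / (b - 1)) with he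
  have he0 : 0 < e := by positivity
  have he1 : e < 1 := by
    rw [he, ← lt_div_iff₀ (by positivity), one_div_div]
    exact hsb
  have hlim : Tendsto (fun M : ℕ => (M : ℝ) ^ (1 - e)) atTop atTop :=
    (tendsto_rpow_atTop (by linarith)).comp tendsto_natCast_atTop_atTop
  obtain ⟨M, hM1, hM⟩ := ((eventually_gt_atTop 1).and
    (hlim.eventually_ge_atTop ((8 * n : ℝ) ^ e))).exists
  have hM0 : (0 : ℝ) < M := by exact_mod_cast (by omega : 0 < M)
  have hM1' : (1 : ℝ) < M := by exact_mod_cast hM1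
  set N : ℝ := 8 * n * M with hN
  have hN1 : 1 < N := by nlinarith
  have hN0 : 0 < N := by linarith
  refine ⟨M, hM1, N ^ (-(1 / (b - 1))), by positivity,
    Real.rpow_lt_one_of_one_lt_of_neg hN1 (by simpa using ha), ?_, ?_⟩
  · have h1 : (N ^ (-(1 / (b - 1)))) ^ (-b) * N ^ (-(1 / (b - 1))) = N := by
      rw [← Real.rpow_mul hN0.le, ← Real.rpow_add hN0]
      convert Real.rpow_one N
      field_simp
      ring
    rw [← mul_div_assoc, h1, lt_div_iff₀ (by positivity), hN]
    nlinarith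
  · have h1 : N ^ (-(b / (b - 1))) ≤ N ^ (-(1 / (b - 1))) / (4 * n * M) := by
      have : -(b / (b - 1)) = -(1 / (b - 1)) - 1 := by field_simp; ring
      rw [this, Real.rpow_sub_one hN0.ne']
      gcongr
      rw [hN]
      gcongr
      norm_num
    have h2 : (N ^ (-(b / (b - 1)))) ^ s = (N ^ e)⁻¹ := by
      rw [← Real.rpow_mul hN0.le, ← Real.rpow_neg hN0.le]
      congr 1
      rw [he]
      ring
    have h3 : N ^ e ≤ M := by
      rw [hN, Real.mul_rpow (by positivity) hM0.le]
      calc (8 * n : ℝ) ^ e * (M : ℝ) ^ e ≤ (M : ℝ) ^ (1 - e) * (M : ℝ) ^ e := by gcongr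
        _ = M := by rw [← Real.rpow_add hM0, sub_add_cancel, Real.rpow_one]
    calc (M : ℝ)⁻¹ ≤ (N ^ e)⁻¹ := by gcongr
      _ = (N ^ (-(b / (b - 1)))) ^ s := h2.symm
      _ ≤ _ := by gcongr

theorem memLp_rescale {n : ℕ} {V : Type*} [NormedAddCommGroup V] {u : Euc n → V} {p : ℝ≥0∞}
    (c : Euc n) {r : ℝ} (hr : 0 < r)
    (hu : ∀ C : Set (Euc n), IsCompact C → MemLp u p (volume.restrict C)) {C : Set (Euc n)}
    (hC : IsCompact C) : MemLp (fun x => u (r⁻¹ • (x - c))) p (volume.restrict C) := by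
  set e := rescaleHomeo c hr.ne' with he
  have h1 : MemLp u p (Measure.map e.toMeasurableEquiv (volume.restrict C)) := by
    have h2 := e.toMeasurableEquiv.restrict_map (volume : Measure (Euc n)) (e '' C)
    rw [Homeomorph.toMeasurableEquiv_coe, preimage_image_eq _ e.injective, he,
      map_rescaleHomeo c hr, Measure.restrict_smul] at h2
    rw [Homeomorph.toMeasurableEquiv_coe, he, ← h2]
    exact (hu _ (hC.image e.continuous)).smul_measure ENNReal.ofReal_ne_top
  exact e.measurableEmbedding.memLp_map_measure_iff.1 h1

theorem exists_weaklyQuasiregular_le_dimH {n : ℕ} {b p K s : ℝ} (hb : 1 < b) (hp : 1 ≤ p)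
    (hbp : b * p < n) (hK : b - 1 ≤ K) (hK' : 1 ≤ K * (b - 1)) (hs : 0 < s)
    (hsb : s < (b - 1) / b) {Ω : Set (Euc n)} (hΩ : IsOpen Ω) (hΩ' : Ω.Nonempty) :
    ∃ f : Euc n → Euc n, MemSobolevLoc Ω (ENNReal.ofReal p) f ∧ IsWeaklyQuasiregular Ω K f ∧
      ENNReal.ofReal (n * s) ≤ dimH (singularSet Ω f) := by
  have hbn : b < n := by nlinarith
  have hn : n ≠ 0 := by rintro rfl; norm_num at hbn; linarith
  have hn1 : (1 : ℝ) ≤ n := by exact_mod_cast Nat.one_le_iff_ne_zero.2 hn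
  obtain ⟨M, hM, t, ht, ht1, hκ, hMs⟩ := exists_grid_parameters hn hb hs hsb
  have hM' : (1 : ℝ) < M := by exact_mod_cast hM
  set β : ℝ := t / (4 * n * M) with hβ
  have hnM : 2 ≤ n * (M : ℝ) := by
    have : (2 : ℝ) ≤ M := by exact_mod_cast hM
    nlinarith
  have hβ0 : 0 < β := by positivity
  have htβ : β * (4 * n * M) = t := by rw [hβ]; field_simp
  have hβt : 3 * β * n * M + 2 * β ≤ t := by nlinarith
  have hβ1 : β < 1 := by nlinarith
  obtain ⟨T, hT, P, hP⟩ := exists_ballPacking_grid (M := M) hβ0 hβt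
  have : Countable T := hT
  obtain ⟨x₀, hx₀⟩ := hΩ'
  obtain ⟨ρ, hρ, hball⟩ := nhds_basis_closedBall.mem_iff.1 (hΩ.mem_nhds hx₀)
  set f : Euc n → Euc n := fun x => P.selfSimilarMap b (ρ⁻¹ • (x - x₀)) with hf
  set g : Euc n → (Euc n →L[ℝ] Euc n) := fun x => ρ⁻¹ • P.selfSimilarDeriv b (ρ⁻¹ • (x - x₀))
    with hg
  have hweak : IsWeakDerivOn univ f g := by
    simpa only [one_smul, one_mul] using
      (BallPacking.isWeakDerivOn_selfSimilarMap (P := P) ht ht1 hb.le hbn).rescale x₀ hρ 1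
  have hc : ∀ j, ‖P.c (Sum.inl j)‖ ≤ 1 - β := fun j => by
    rw [(hP j).1]
    linarith [norm_gridPoint_le hβ0.le j]
  refine ⟨f, ⟨g, hweak.restrict Ω, fun C _ hC => ⟨?_, ?_⟩⟩,
    ⟨g, hweak.restrict Ω, Or.inr (ae_restrict_of_ae ?_), ae_restrict_of_ae ?_⟩, ?_⟩
  · exact memLp_rescale x₀ hρ (fun C hC => BallPacking.memLp_selfSimilarMap ht ht1 hb.le hp hbp hC) hC
  · exact (memLp_rescale x₀ hρ
      (fun C hC => BallPacking.memLp_selfSimilarDeriv ht ht1 hb.le hp hbp hC) hC).const_smul ρ⁻¹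
  · filter_upwards [(quasiMeasurePreserving_rescale x₀ hρ).ae
      (BallPacking.ae_isReversingQuasiconformal (P := P) ht ht1 hb hbn hK hK')] with x hx
    exact (hx.smul (inv_nonneg.2 hρ.le)).1
  · filter_upwards [(quasiMeasurePreserving_rescale x₀ hρ).ae
      (BallPacking.ae_isReversingQuasiconformal (P := P) ht ht1 hb hbn hK hK')] with x hx
    exact (hx.smul (inv_nonneg.2 hρ.le)).2
  · refine (BallPacking.le_dimH_range_limitPoint (P := P) hM hβ0 hβ1 (e := Sum.inl) hc
      (fun j j' hne => ?_) hs hMs x₀ hρ).trans (dimH_mono ?_)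
    · rw [(hP j).1, (hP j').1]
      exact le_dist_gridPoint hβ0.le hne
    · rintro _ ⟨z, rfl⟩
      exact BallPacking.mem_singularSet hn ht ht1 hb.le hbn hβ0 hβ1 hκ (fun k => (hP _).2)
        (fun k => hc _) hρ hball

theorem exists_weaklyQuasiregular_of_lt {n : ℕ} {b p K d : ℝ} (hb : 1 < b) (hp : 1 ≤ p)
    (hbp : b * p < n) (hK : b - 1 ≤ K) (hK' : 1 ≤ K * (b - 1)) (hd : d < n - n / b)
    {Ω : Set (Euc n)} (hΩ : IsOpen Ω) (hΩ' : Ω.Nonempty) :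
    ∃ f : Euc n → Euc n, MemSobolevLoc Ω (ENNReal.ofReal p) f ∧ IsWeaklyQuasiregular Ω K f ∧
      ENNReal.ofReal d ≤ dimH (singularSet Ω f) := by
  have hn : (0 : ℝ) < n := by nlinarith
  have h1 : d / n < (b - 1) / b := by
    rw [div_lt_iff₀ hn]
    refine hd.trans_eq ?_
    field_simp
  -- The maximum with `0` keeps `s` positive even when `d` is negative.
  obtain ⟨s, hs, hs'⟩ := exists_between (max_lt (div_pos (sub_pos.2 hb) (by positivity)) h1)
  obtain ⟨h2, h3⟩ := max_lt_iff.1 hs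
  obtain ⟨f, hf, hf', hf''⟩ := exists_weaklyQuasiregular_le_dimH hb hp hbp hK hK' h2 hs' hΩ hΩ'
  refine ⟨f, hf, hf', (ENNReal.ofReal_le_ofReal ?_).trans hf''⟩
  rw [div_lt_iff₀ hn] at h3
  linarith

theorem theorem1p2 (n : ℕ) (hn : 3 ≤ n) :
    (∀ K : ℝ, 1 ≤ K → ∀ ε : ℝ, 0 < ε →
      ∀ Ω : Set (EuclideanSpace ℝ (Fin n)), IsOpen Ω → Ω.Nonempty →
        ∃ f : EuclideanSpace ℝ (Fin n) → EuclideanSpace ℝ (Fin n),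
          MemSobolevLoc Ω 1 f ∧ IsWeaklyQuasiregular Ω K f ∧
            ENNReal.ofReal (min ((n : ℝ) * K / (K + 1)) ((n : ℝ) - 1) - ε)
              ≤ dimH (singularSet Ω f)) ∧
    (∀ p : ℝ, 1 < p → p < n → ∃ Kp : ℝ, 1 ≤ Kp ∧ ∀ ε : ℝ, 0 < ε →
      ∀ Ω : Set (EuclideanSpace ℝ (Fin n)), IsOpen Ω → Ω.Nonempty →
        ∃ f : EuclideanSpace ℝ (Fin n) → EuclideanSpace ℝ (Fin n),
          MemSobolevLoc Ω (ENNReal.ofReal p) f ∧ IsWeaklyQuasiregular Ω Kp f ∧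
            ENNReal.ofReal ((n : ℝ) - p - ε) ≤ dimH (singularSet Ω f)) := by
  have hn3 : (3 : ℝ) ≤ n := by exact_mod_cast hn
  refine ⟨fun K hK ε hε Ω hΩ hΩ' => ?_, fun p hp hpn => ?_⟩
  · rw [← ENNReal.ofReal_one]
    rcases lt_or_ge K ((n : ℝ) - 1) with h | h
    · refine exists_weaklyQuasiregular_of_lt (b := K + 1) (by linarith) le_rfl (by linarith)
        (by linarith) (by nlinarith) ?_ hΩ hΩ'
      have : (n : ℝ) - n / (K + 1) = n * K / (K + 1) := by field_simp; ring
      rw [this]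
      linarith [min_le_left ((n : ℝ) * K / (K + 1)) ((n : ℝ) - 1)]
    -- Here `b = K + 1` would violate `b < n`. Taking `b = n - δ` instead gives dimensions near `n -
    -- 1`.
    · set δ := min (1 / 2) ε with hδ
      have hδ0 : 0 < δ := lt_min (by norm_num) hε
      have hδ1 : δ ≤ 1 / 2 := min_le_left _ _
      have hδε : δ ≤ ε := min_le_right _ _
      refine exists_weaklyQuasiregular_of_lt (b := n - δ) (by linarith) le_rfl (by linarith)
        (by linarith) (by nlinarith) ?_ hΩ hΩ'
      have : (n : ℝ) / (n - δ) < 1 + ε := by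
        rw [div_lt_iff₀ (by linarith)]
        nlinarith
      linarith [min_le_right ((n : ℝ) * K / (K + 1)) ((n : ℝ) - 1)]
  · set a : ℝ := n / p - 1 with ha
    have hp0 : 0 < p := by linarith
    have ha0 : 0 < a := by rw [ha, sub_pos, one_lt_div hp0]; exact hpn
    have hap : (a + 1) * p = n := by rw [ha]; field_simp; ring
    -- The exponent will satisfy `a / 2 ≤ b - 1 ≤ a`, so this constant bounds both `b - 1` and `1 /
    -- (b - 1)` independently of `ε`.
    refine ⟨max 1 (max a (2 / a)), le_max_left _ _, fun ε hε Ω hΩ hΩ' => ?_⟩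
    -- Since `(a + 1) p = n`, the goal `n / (a + 1 - δ) < p + ε` means `(p + ε) δ < ε n / p`; the
    -- second entry meets it with a factor `2` to spare.
    set δ := min (a / 2) (ε * n / (2 * p * (p + ε))) with hδ
    have hδ0 : 0 < δ := lt_min (by positivity) (by positivity)
    have hδ1 : δ ≤ a / 2 := min_le_left _ _
    have hδε : δ * (2 * p * (p + ε)) ≤ ε * n := by
      rw [← le_div_iff₀ (by positivity)]
      exact min_le_right _ _
    refine exists_weaklyQuasiregular_of_lt (b := a + 1 - δ) (by linarith) hp.le ?_ ?_ ?_ ?_ hΩ hΩ'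
    · rw [sub_mul, hap]
      linarith [mul_pos hδ0 hp0]
    · linarith [le_max_left a (2 / a), le_max_right 1 (max a (2 / a))]
    · have h1 : 2 / a ≤ max 1 (max a (2 / a)) := (le_max_right _ _).trans (le_max_right _ _)
      calc (1 : ℝ) = 2 / a * (a / 2) := by field_simp
        _ ≤ _ := mul_le_mul h1 (by linarith) (by positivity) ((by positivity : 0 ≤ 2 / a).trans h1)
    · have : (n : ℝ) / (a + 1 - δ) < p + ε := by
        rw [div_lt_iff₀ (by linarith)]
        have : 0 < ε * (n : ℝ) := by positivity
        have h2 : (p + ε) * (a + 1) = n + ε * (a + 1) := by rw [← hap]; ring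
        have h3 : ε * (a + 1) * p = ε * n := by rw [← hap]; ring
        have h4 : (p + ε) * δ < ε * (a + 1) := by
          refine lt_of_mul_lt_mul_right (a := p) ?_ hp0.le
          rw [h3]
          nlinarith
        nlinarith
      linarith
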